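/- Let $\mathcal H$ be a separable complex Hilbert space; times range over $[0,\infty)$. **Data.** Let $\Lambda\ge I$ be a self-adjoint operator and, for $t\ge 0$, let $A_t$ be a normal completely positive map on $\mathcal B(\mathcal H)$, ultraweakly continuous in $t$. The (unbounded) CP-map $\Phi_t$ is given by the quadratic forms $\Phi_t(X)[\psi]=\langle\Lambda^{1/2}\psi,A_t(X)\Lambda^{1/2}\psi\rangle$ on $\mathrm{dom}\,\Lambda^{1/2}$, i.e. $A_t=\Lambda^{-1/2}\Phi_t(\cdot)\Lambda^{-1/2}$. Consider the Markov master equation $$\partial_t P_{\tau,t}(B)=\Phi_t(P_{\tau,t}(B))-G_t^*P_{\tau,t}(B)-P_{\tau,t}(B)G_t,\qquad P_{\tau,\tau}(B)=B. \tag{1.1}$$ **Domain and continuity conditions.** 1. The operators $G_t$ are closed and densely defined, with a joint core $\mathcal D$ such that $\mathcal D\subseteq\mathrm{dom}\,G_t^N$ for some $N\ge2$ and $\mathcal D\subseteq \mathrm{dom}\,\Lambda^{1/2}$. 2. There is a strongly continuous family of contractions $W_{s,t}$ $(0\le s\le t)$ with $W_{t,t}=I$, $W_{s,r}W_{r,t}=W_{s,t}$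 for $s\le r\le t$, $W_{s,t}\mathcal D\subseteq\mathcal D$, and, strongly on $\mathcal D$, $\partial_tW_{s,t}=-W_{s,t}G_t$ and $\partial_sW_{s,t}=G_sW_{s,t}$. 3. $\Lambda\ge\Phi_t(I)\ge I$ as forms on $\mathrm{dom}\,\Lambda^{1/2}$, and $G_t^*+G_t=\Phi_t(I)$ as forms on $\mathcal D$. 4. For every $\psi\in\mathcal D$, $\Lambda^{1/2}W_{s,t}\psi$ is square integrable in $s\in[0,t]$ and norm-continuous in $t\in[s,\infty)$. **Minimal solution.** Let $P^{(0)}_{\tau,t}(B)=W_{\tau,t}^*BW_{\tau,t}$, and let $P^{(n+1)}_{\tau,t}(B)$ be the bounded operator determined by $$\langle\psi,P^{(n+1)}_{\tau,t}(B)\psi\rangle=\langle W_{\tau,t}\psi,BW_{\tau,t}\psi\rangle+\int_\tau^t\Phi_s\bigl(P^{(n)}_{\tau,s}(B)\bigr)[W_{s,t}\psi]\,ds\qquad(\psi\in\mathcal D).$$ For $B\ge0$ the minimal solution of (1.1) is $P^{\min}_{\tau,t}(B)=\mathrm{l.u.b.}_n\,P^{(n)}_{\tau,t}(B)$. For a positive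 self-adjoint unbounded $T$, the forms $\Phi_t(T)[\psi]$ and $P^{\min}_{\tau,t}(T)[\psi]$, with values in $[0,\infty]$, are the suprema of $\Phi_t(X)[\psi]$ and $P^{\min}_{\tau,t}(X)[\psi]$ over bounded $X$ with $0\le X\le T$. **Reference family.** A family of self-adjoint operators $\Lambda_t\ge I$ $(t\ge0)$ is a reference family if: 1. $\mathcal D\subseteq\mathrm{dom}\,\Lambda_t$, $\mathcal D$ is a core of $\Lambda_t^{1/2}$, and $\Lambda_t\ge\Phi_t(I)$ as forms on $\mathcal D$. 2. For $\psi\in\mathcal D$ the map $t\mapsto\Lambda_t\psi$ is differentiable, with derivative denoted $\dot\Lambda_t\psi$, and $s\mapsto\|\Lambda_s^{1/2}W_{s,t}\psi\|^2$ is continuous on $[0,t]$. 3. The operators $\Lambda^{-1/2}\Lambda_t\Lambda^{-1/2}$ are densely defined and have continuations to $\mathcal H$ that are uniformly bounded and strongly continuous in $t$. 4. There is $c\in L_1^{loc}([0,\infty))$, $c_t\ge0$, such that for all $t\ge0$ and $\psi\in\mathcal D$ $$\Phi_t(\Lambda_t)[\psi]-2\,\mathrm{Re}\,\langle G_t\psi,\Lambda_t\psi\rangle-\langle\psi,\dot\Lambda_t\psi\rangle\le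 c_t\,\|\Lambda_t^{1/2}\psi\|^2 .\tag{2.1}$$ **Theorem.** Assume the domain and continuity conditions, and let $(\Lambda_t)$ be a reference family with rate $c$. Then all $P^{(n)}_{\tau,t}(B)$ with $B\in\mathcal B(\mathcal H)$, and all $P^{\min}_{\tau,t}(B)$ with $B\ge 0$, are well defined. For all $0\le\tau\le t$ the a priori bound $$P^{\min}_{\tau,t}(\Lambda_\tau)\le\Lambda_t\,\exp\Bigl(\int_\tau^tc_s\,ds\Bigr)$$ holds as forms on $\mathrm{dom}\,\Lambda_t^{1/2}$. Moreover the minimal solution of (1.1) is unital: $P^{\min}_{\tau,t}(I)=I$ for all $0\le\tau\le t$. -/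

import Mathlib

open Set MeasureTheory
open scoped ENNReal InnerProductSpace CStarAlgebra

noncomputable section

namespace MME

variable {H : Type*} [NormedAddCommGroup H] [InnerProductSpace ℂ H] [CompleteSpace H]

/-! ### Unbounded operators -/

/-- The value `T x` of an unbounded operator, extended by `0` outside the domain of `T`. -/
def ev (T : H →ₗ.[ℂ] H) (x : H) : H :=
  open Classical in if h : x ∈ T.domain then T ⟨x, h⟩ else 0

/-- The domain of the power `T ^ n`. -/
def domPow (T : H →ₗ.[ℂ] H) : ℕ → Set H
  | 0 => univ
  | n + 1 => {x | x ∈ T.domain ∧ ev T x ∈ domPow T n}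

/-- `T` is self-adjoint and `T ≥ I`. -/
structure IsSelfAdjointGeOne (T : H →ₗ.[ℂ] H) : Prop where
  isSelfAdjoint : IsSelfAdjoint T
  one_le : ∀ x : T.domain, ‖(x : H)‖ ^ 2 ≤ (⟪(x : H), T x⟫_ℂ).re

/-- The bounded operator `R` is the two-sided inverse of the unbounded operator `T`. -/
def IsInverse (T : H →ₗ.[ℂ] H) (R : H →L[ℂ] H) : Prop :=
  (∀ y : H, ∃ h : R y ∈ T.domain, T ⟨R y, h⟩ = y) ∧ ∀ x : T.domain, R (T x) = x

/-- The bounded inverse `T⁻¹` (it exists for every self-adjoint `T ≥ I`). -/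
def inv (T : H →ₗ.[ℂ] H) : H →L[ℂ] H :=
  open Classical in if h : ∃ R, IsInverse T R then h.choose else 0

/-- The bounded positive operator `T^{-1/2}`, for self-adjoint `T ≥ I`. -/
def invSqrt (T : H →ₗ.[ℂ] H) : H →L[ℂ] H := CFC.sqrt (inv T)

/-- The positive self-adjoint square root `T^{1/2}`, for self-adjoint `T ≥ I`: the inverse of the
injective bounded operator `T^{-1/2}`, with domain the range of `T^{-1/2}`. -/
def sqrtOp (T : H →ₗ.[ℂ] H) : H →ₗ.[ℂ] H :=
  (((invSqrt T : H →L[ℂ] H) : H →ₗ[ℂ] H).toPMap ⊤).inverse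

/-- `X ≤ T` in the sense of quadratic forms, for a bounded `X` and an unbounded self-adjoint `T`. -/
def LeOp (X : H →L[ℂ] H) (T : H →ₗ.[ℂ] H) : Prop :=
  ∀ x : T.domain, (⟪(x : H), X x⟫_ℂ).re ≤ (⟪(x : H), T x⟫_ℂ).re

/-- Canonical extension of a monotone map `m`, sending bounded positive operators to quadratic
forms, to a positive self-adjoint operator `T`: the form
`ψ ↦ sup {m(X)[ψ] : X bounded, 0 ≤ X ≤ T}`, with values in `[0, ∞]`. If `m(X) = ∑ₖ Lₖ* X Lₖ`,
this is `∑ₖ ‖T^{1/2} Lₖ ψ‖²`. -/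
def extendForm (m : (H →L[ℂ] H) → H → ℂ) (T : H →ₗ.[ℂ] H) (ψ : H) : ℝ≥0∞ :=
  ⨆ (X : H →L[ℂ] H) (_ : 0 ≤ X) (_ : LeOp X T), ENNReal.ofReal (m X ψ).re

/-! ### Ultraweak topology -/

/-- Ultraweakly continuous functionals on `B(H)`: `X ↦ ∑ₙ ⟨xₙ, X yₙ⟩` with
`∑ₙ ‖xₙ‖² < ∞` and `∑ₙ ‖yₙ‖² < ∞`. -/
def IsUltraweak (ω : (H →L[ℂ] H) →ₗ[ℂ] ℂ) : Prop :=
  ∃ x y : ℕ → H, Summable (fun n => ‖x n‖ ^ 2) ∧ Summable (fun n => ‖y n‖ ^ 2) ∧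
    ∀ X : H →L[ℂ] H, HasSum (fun n => ⟪x n, X (y n)⟫_ℂ) (ω X)

/-- A linear map on `B(H)` is normal if it is ultraweakly continuous, i.e. if it pulls ultraweakly
continuous functionals back to ultraweakly continuous functionals. -/
def IsNormalMap (A : (H →L[ℂ] H) →ₗ[ℂ] (H →L[ℂ] H)) : Prop :=
  ∀ ω : (H →L[ℂ] H) →ₗ[ℂ] ℂ, IsUltraweak ω → IsUltraweak (ω ∘ₗ A)

/-! ### Bounded operators from densely defined forms -/

/-- The bounded operator whose quadratic form on `D` is `q` (unique if `D` is dense), and `0` if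
there is none. -/
def opOfForm (D : Submodule ℂ H) (q : H → ℂ) : H →L[ℂ] H :=
  open Classical in if h : ∃ T : H →L[ℂ] H, ∀ ψ ∈ D, ⟪ψ, T ψ⟫_ℂ = q ψ then h.choose else 0

end MME

/-- The data of a time-dependent Markov master equation on `B(H)`,
`∂ₜ P = Φₜ(P) - Gₜ* P - P Gₜ`, for times `t ≥ 0`: a dominating operator `Λ`, the maps
`Aₜ = Λ^{-1/2} Φₜ(·) Λ^{-1/2}` (which encode the unbounded CP-maps `Φₜ`), the operators `Gₜ`, the
evolution system `W s t`, and the joint core `D ⊆ dom Gₜ^N`. -/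
structure MarkovMasterEquation (H : Type*) [NormedAddCommGroup H] [InnerProductSpace ℂ H]
    [CompleteSpace H] where
  Λ : H →ₗ.[ℂ] H
  A : ℝ → ((H →L[ℂ] H) →CP (H →L[ℂ] H))
  G : ℝ → (H →ₗ.[ℂ] H)
  W : ℝ → ℝ → (H →L[ℂ] H)
  D : Submodule ℂ H
  N : ℕ

namespace MarkovMasterEquation

open MME

variable {H : Type*} [NormedAddCommGroup H] [InnerProductSpace ℂ H] [CompleteSpace H]
  (M : MarkovMasterEquation H)

/-- `Λ^{1/2} x` (for `x ∈ dom Λ^{1/2}`). -/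
def sq (x : H) : H := ev (sqrtOp M.Λ) x

/-- The sesquilinear form of `Φₜ(X) = Λ^{1/2} Aₜ(X) Λ^{1/2}`, on `dom Λ^{1/2}`. -/
def phi (t : ℝ) (X : H →L[ℂ] H) (φ ψ : H) : ℂ := ⟪M.sq φ, M.A t X (M.sq ψ)⟫_ℂ

/-- The quadratic form `Φₜ(T)[ψ] ∈ [0, ∞]` for positive self-adjoint unbounded `T`. -/
def phiExt (t : ℝ) (T : H →ₗ.[ℂ] H) (ψ : H) : ℝ≥0∞ :=
  extendForm (fun X ψ => M.phi t X ψ ψ) T ψ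

/-- Strongly continuous contractive evolution system `W s t`, `0 ≤ s ≤ t`, generated by `Gₜ`:
`∂ₜ W s t = - W s t Gₜ` and `∂ₛ W s t = Gₛ W s t` strongly on the invariant core `D`. -/
structure IsEvolutionSystem : Prop where
  norm_le : ∀ s t, 0 ≤ s → s ≤ t → ‖M.W s t‖ ≤ 1
  refl : ∀ t, 0 ≤ t → M.W t t = 1
  comp : ∀ s r t, 0 ≤ s → s ≤ r → r ≤ t → M.W s r * M.W r t = M.W s t
  continuousOn : ∀ ψ : H,
    ContinuousOn (fun p : ℝ × ℝ => M.W p.1 p.2 ψ) {p | 0 ≤ p.1 ∧ p.1 ≤ p.2}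
  maps_core : ∀ s t, 0 ≤ s → s ≤ t → ∀ ψ ∈ M.D, M.W s t ψ ∈ M.D
  deriv_right : ∀ s t, 0 ≤ s → s ≤ t → ∀ ψ ∈ M.D,
    HasDerivWithinAt (fun r => M.W s r ψ) (-(M.W s t (ev (M.G t) ψ))) (Ici s) t
  deriv_left : ∀ s t, 0 ≤ s → s ≤ t → ∀ ψ ∈ M.D,
    HasDerivWithinAt (fun r => M.W r t ψ) (ev (M.G s) (M.W s t ψ)) (Icc 0 t) s

/-- The domain and continuity conditions. -/
structure DomainContinuity : Prop where
  evolution : M.IsEvolutionSystem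
  two_le_N : 2 ≤ M.N
  G_dense : ∀ t, 0 ≤ t → Dense ((M.G t).domain : Set H)
  G_closed : ∀ t, 0 ≤ t → (M.G t).IsClosed
  core : ∀ t, 0 ≤ t → (M.G t).HasCore M.D
  core_pow : ∀ t, 0 ≤ t → (M.D : Set H) ⊆ domPow (M.G t) M.N
  Λ_ge : IsSelfAdjointGeOne M.Λ
  D_le : M.D ≤ (sqrtOp M.Λ).domain
  /-- `Gₜ* + Gₜ = Φₜ(I)` on `D` (as forms) -/
  G_add_adjoint : ∀ t, 0 ≤ t → ∀ φ ∈ M.D, ∀ ψ ∈ M.D,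
    ⟪ev (M.G t) φ, ψ⟫_ℂ + ⟪φ, ev (M.G t) ψ⟫_ℂ = M.phi t 1 φ ψ
  /-- `Λ ≥ Φₜ(I)` -/
  phi_one_le : ∀ t, 0 ≤ t → ∀ ψ ∈ (sqrtOp M.Λ).domain, (M.phi t 1 ψ ψ).re ≤ ‖M.sq ψ‖ ^ 2
  /-- `Φₜ(I) ≥ I` -/
  one_le_phi : ∀ t, 0 ≤ t → ∀ ψ ∈ (sqrtOp M.Λ).domain, ‖ψ‖ ^ 2 ≤ (M.phi t 1 ψ ψ).re
  normal : ∀ t, 0 ≤ t → IsNormalMap (M.A t).toLinearMap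
  ultraweak_continuous : ∀ X : H →L[ℂ] H, ∀ ω : (H →L[ℂ] H) →ₗ[ℂ] ℂ, IsUltraweak ω →
    ContinuousOn (fun t => ω (M.A t X)) (Ici 0)
  sq_memLp : ∀ ψ ∈ M.D, ∀ t, 0 ≤ t →
    MemLp (fun s => M.sq (M.W s t ψ)) 2 (volume.restrict (Icc 0 t))
  sq_continuous : ∀ ψ ∈ M.D, ∀ s, 0 ≤ s →
    ContinuousOn (fun t => M.sq (M.W s t ψ)) (Ici s)

/-- `L t`, `t ≥ 0`, is a reference family with rate `c`. -/
structure IsReferenceFamily (L : ℝ → (H →ₗ.[ℂ] H)) (c : ℝ → ℝ) : Prop where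
  ge_one : ∀ t, 0 ≤ t → IsSelfAdjointGeOne (L t)
  D_le : ∀ t, 0 ≤ t → M.D ≤ (L t).domain
  core : ∀ t, 0 ≤ t → (sqrtOp (L t)).HasCore M.D
  phi_one_le : ∀ t, 0 ≤ t → ∀ ψ ∈ M.D, (M.phi t 1 ψ ψ).re ≤ ‖ev (sqrtOp (L t)) ψ‖ ^ 2
  /-- strong differentiability on `D`, with `D ⊆ dom (dL/dt)` -/
  differentiable : ∀ ψ ∈ M.D, DifferentiableOn ℝ (fun t => ev (L t) ψ) (Ici 0)
  /-- continuity along the evolution system -/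
  continuous_along : ∀ ψ ∈ M.D, ∀ t, 0 ≤ t →
    ContinuousOn (fun s => ‖ev (sqrtOp (L s)) (M.W s t ψ)‖ ^ 2) (Icc 0 t)
  /-- `Λ^{-1/2} L t Λ^{-1/2}` is densely defined and has a uniformly bounded, strongly continuous
  continuation to `H`. -/
  relatively_bounded :
    (∀ t, 0 ≤ t → Dense {x : H | invSqrt M.Λ x ∈ (L t).domain}) ∧
    ∃ B : ℝ → (H →L[ℂ] H),
      (∀ t, 0 ≤ t → ∀ x, invSqrt M.Λ x ∈ (L t).domain →
        B t x = invSqrt M.Λ (ev (L t) (invSqrt M.Λ x))) ∧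
      (∃ K : ℝ, ∀ t, 0 ≤ t → ‖B t‖ ≤ K) ∧
      ∀ x : H, ContinuousOn (fun t => B t x) (Ici 0)
  rate_nonneg : ∀ t, 0 ≤ t → 0 ≤ c t
  rate_integrable : LocallyIntegrableOn c (Ici 0)
  /-- the differential inequality -/
  inequality : ∀ t, 0 ≤ t → ∀ ψ ∈ M.D, M.phiExt t (L t) ψ ≠ ∞ ∧
    (M.phiExt t (L t) ψ).toReal - 2 * (⟪ev (M.G t) ψ, ev (L t) ψ⟫_ℂ).re
      - (⟪ψ, derivWithin (fun r => ev (L r) ψ) (Ici 0) t⟫_ℂ).re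
      ≤ c t * ‖ev (sqrtOp (L t)) ψ‖ ^ 2

/-- The successive approximations: `P⁽⁰⁾(B) = W* B W`, and `P⁽ⁿ⁺¹⁾(B)` is the bounded operator with
form `V_{τ,t}(B)[ψ] + ∫_τ^t Φₛ(P⁽ⁿ⁾_{τ,s}(B))[W s t ψ] ds`, `ψ ∈ D`. -/
def P : ℕ → ℝ → ℝ → (H →L[ℂ] H) → (H →L[ℂ] H)
  | 0, τ, t, B => star (M.W τ t) * B * M.W τ t
  | n + 1, τ, t, B => opOfForm M.D fun ψ =>
      ⟪M.W τ t ψ, B (M.W τ t ψ)⟫_ℂ +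
        ∫ s in τ..t, M.phi s (P n τ s B) (M.W s t ψ) (M.W s t ψ)

/-- `P⁽ⁿ⁺¹⁾` is well defined: the integral converges and the form on `D` is that of a bounded
operator. -/
def IteratesWellDefined : Prop :=
  ∀ (n : ℕ) (τ t : ℝ), 0 ≤ τ → τ ≤ t → ∀ B : H →L[ℂ] H, ∀ ψ ∈ M.D,
    IntervalIntegrable (fun s => M.phi s (M.P n τ s B) (M.W s t ψ) (M.W s t ψ)) volume τ t ∧
    ⟪ψ, M.P (n + 1) τ t B ψ⟫_ℂ = ⟪M.W τ t ψ, B (M.W τ t ψ)⟫_ℂ +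
      ∫ s in τ..t, M.phi s (M.P n τ s B) (M.W s t ψ) (M.W s t ψ)

/-- The minimal solution on `B ≥ 0`: the least upper bound of the successive approximations. -/
def Pmin (τ t : ℝ) (B : H →L[ℂ] H) : H →L[ℂ] H :=
  open Classical in if h : ∃ T, IsLUB (range fun n => M.P n τ t B) T then h.choose else 0

/-- The quadratic form of the minimal solution at a positive self-adjoint unbounded `T`. -/
def PminExt (τ t : ℝ) (T : H →ₗ.[ℂ] H) (ψ : H) : ℝ≥0∞ :=
  extendForm (fun X ψ => ⟪ψ, M.Pmin τ t X ψ⟫_ℂ) T ψ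

end MarkovMasterEquation

end

/-!
The integral equation defines a positive linear operator `J` on weakly measurable bounded families,
and the iteration reads `P⁽ⁿ⁺¹⁾ = P⁽⁰⁾ + J(P⁽ⁿ⁾)`. The energy balance `1 = P⁽⁰⁾(1) + J(1)`, from
`Gₜ* + Gₜ = Φₜ(I)`, makes the iterates increasing and bounded.

For the a priori bound one differentiates `f s = ‖L s ^ {1/2} W s t ψ‖²`. Only `L r φ` for a fixed
`φ ∈ D` is known to be differentiable in `r`, but since `L r ≥ 0` the form of `L r` at `W r t ψ` is
bounded below by its linearization at `W s t ψ`. Hence `f` satisfies a one-sided differential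
inequality for its lower right Dini derivative, which integrates by the Vitali–Carathéodory theorem,
and Grönwall's inequality propagates the bound from `P⁽ⁿ⁾` to `P⁽ⁿ⁺¹⁾`.

The defects `1 - P⁽ᵏ⁾(1)` are `J^{k+1}(1)`, and their sum, the expected number of jumps, is the
limit of `N_{n+1} = J(1 + N_n)`. As `Φₛ(I) ≤ L s`, the same estimate with rate `c + 1` bounds it,
so the decreasing defects tend to `0`.
-/

open Filter Topology

noncomputable section

namespace MME

/-! ### Integral inequalities on the line -/

section LineIntegrals

variable {a b : ℝ}

theorem eventually_mul_le_integral_of_lowerSemicontinuous {G : ℝ → EReal} {x y : ℝ} (hxb : x < b)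
    (hG : LowerSemicontinuous G) (hint : IntegrableOn (fun u => (G u).toReal) (Icc x b))
    (htop : ∀ᵐ u ∂volume.restrict (Icc x b), G u < ⊤) (hy : (y : EReal) < G x) :
    ∀ᶠ u in 𝓝[>] x, (u - x) * y ≤ ∫ r in x..u, (G r).toReal := by
  obtain ⟨u₀, hxu₀, hlt⟩ := mem_nhdsGE_iff_exists_Icc_subset.1 <|
    mem_nhdsWithin_of_mem_nhds (hG.lowerSemicontinuousAt x y hy)
  filter_upwards [Ioc_mem_nhdsGT (lt_min hxu₀ hxb)] with u hu
  have hub : Icc x u ⊆ Icc x b := Icc_subset_Icc_right (hu.2.trans (min_le_right _ _))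
  have hle : ∀ᵐ r ∂volume.restrict (Icc x u), y ≤ (G r).toReal := by
    filter_upwards [ae_restrict_of_ae_restrict_of_subset hub htop,
      ae_restrict_mem measurableSet_Icc] with r htop hr
    have hyr : (y : EReal) < G r := hlt ⟨hr.1, hr.2.trans (hu.2.trans (min_le_left _ _))⟩
    exact EReal.toReal_le_toReal hyr.le (EReal.coe_ne_bot y) htop.ne
  rw [← smul_eq_mul, ← intervalIntegral.integral_const]
  exact intervalIntegral.integral_mono_ae_restrict hu.1.le intervalIntegrable_const
    ((intervalIntegrable_iff_integrableOn_Icc_of_le hu.1.le).2 (hint.mono_set hub)) hle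

/-- The fencing inequality is applied to `g - ∫ G` for a lower semicontinuous majorant `G` of `φ`
whose integral exceeds that of `φ` by less than `ε` (Vitali-Carathéodory). -/
theorem sub_le_integral_of_dini_le {g φ : ℝ → ℝ} (hab : a ≤ b) (hg : ContinuousOn g (Icc a b))
    (hφ : IntervalIntegrable φ volume a b)
    (hdini : ∀ x ∈ Ico a b, ∀ y, φ x < y → ∀ᶠ u in 𝓝[>] x, g u - g x ≤ (u - x) * y) :
    g b - g a ≤ ∫ x in a..b, φ x := by
  rw [intervalIntegrable_iff_integrableOn_Icc_of_le hab] at hφ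
  refine le_of_forall_pos_lt_add fun ε hε => ?_
  obtain ⟨G, hφG, hG, hGint, hGtop, hGε⟩ := exists_lt_lowerSemicontinuous_integral_lt φ hφ hε
  change IntegrableOn _ _ volume at hGint
  have hGi {u v : ℝ} (hu : a ≤ u) (huv : u ≤ v) (hv : v ≤ b) :
      IntervalIntegrable (fun r => (G r).toReal) volume u v :=
    (intervalIntegrable_iff_integrableOn_Icc_of_le huv).2 (hGint.mono_set (Icc_subset_Icc hu hv))
  have hcont : ContinuousOn (fun x => ∫ r in a..x, (G r).toReal) (Icc a b) := by
    rw [← uIcc_of_le hab] at hGint ⊢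
    exact intervalIntegral.continuousOn_primitive_interval hGint
  have hfence := image_le_of_liminf_slope_right_le_deriv_boundary (f := fun x =>
    g x - ∫ r in a..x, (G r).toReal) (B := fun _ => g a) (B' := 0) (hg.sub hcont) (by simp)
    continuousOn_const (fun x _ => hasDerivWithinAt_const x _ _) ?_ (right_mem_Icc.2 hab)
  · have hG_eq : ∫ r in a..b, (G r).toReal = ∫ r in Icc a b, (G r).toReal := by
      rw [intervalIntegral.integral_of_le hab, integral_Icc_eq_integral_Ioc]
    have hφ_eq : ∫ r in a..b, φ r = ∫ r in Icc a b, φ r := by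
      rw [intervalIntegral.integral_of_le hab, integral_Icc_eq_integral_Ioc]
    linarith
  intro x hx r hr
  obtain ⟨y, hφy, hyG⟩ := EReal.lt_iff_exists_real_btwn.1 (hφG x)
  have hsub : Icc x b ⊆ Icc a b := Icc_subset_Icc_left hx.1
  refine Eventually.frequently ?_
  filter_upwards [hdini x hx y (EReal.coe_lt_coe_iff.1 hφy), Ioc_mem_nhdsGT hx.2,
    eventually_mul_le_integral_of_lowerSemicontinuous hx.2 hG (hGint.mono_set hsub)
      (ae_restrict_of_ae_restrict_of_subset hsub hGtop) hyG] with u hgu hu hGu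
  have hadd := intervalIntegral.integral_add_adjacent_intervals
    (hGi le_rfl hx.1 hx.2.le) (hGi hx.1 hu.1.le hu.2)
  refine lt_of_le_of_lt ?_ hr
  rw [slope_def_field]
  exact div_nonpos_of_nonpos_of_nonneg (by linarith) (sub_nonneg.2 hu.1.le)

theorem absolutelyContinuousOnInterval_comp {X Y : Type*} [PseudoMetricSpace X]
    [PseudoMetricSpace Y] {g : X → Y} {f : ℝ → X} {K : NNReal}
    (hg : LipschitzOnWith K g (f '' uIcc a b)) (hf : AbsolutelyContinuousOnInterval f a b) :
    AbsolutelyContinuousOnInterval (fun x => g (f x)) a b := by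
  rw [absolutelyContinuousOnInterval_iff] at hf ⊢
  intro ε hε
  obtain ⟨δ, hδ, h⟩ := hf (ε / (K + 1)) (by positivity)
  refine ⟨δ, hδ, fun E hE hlt => lt_of_le_of_lt ?_ ((lt_div_iff₀' (by positivity)).1 (h E hE hlt))⟩
  rw [Finset.mul_sum]
  gcongr with i hi
  have hmem := hE.1 i hi
  calc dist (g (f (E.2 i).1)) (g (f (E.2 i).2))
      ≤ K * dist (f (E.2 i).1) (f (E.2 i).2) :=
        hg.dist_le_mul _ (mem_image_of_mem f hmem.1) _ (mem_image_of_mem f hmem.2)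
    _ ≤ (K + 1) * dist (f (E.2 i).1) (f (E.2 i).2) := by gcongr; simp

theorem absolutelyContinuousOnInterval_exp {f : ℝ → ℝ}
    (hf : AbsolutelyContinuousOnInterval f a b) :
    AbsolutelyContinuousOnInterval (fun x => Real.exp (f x)) a b := by
  obtain ⟨R, hR⟩ := hf.exists_bound
  obtain ⟨K, hK⟩ := (Real.contDiff_exp (n := 1)).contDiffOn.exists_lipschitzOnWith one_ne_zero
    (convex_Icc (-R) R) isCompact_Icc
  exact absolutelyContinuousOnInterval_comp
    (hK.mono (image_subset_iff.2 fun x hx => abs_le.1 (hR x hx))) hf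

theorem integral_exp_mul_deriv_add {C c k κ : ℝ → ℝ} (hC : AbsolutelyContinuousOnInterval C a b)
    (hk : AbsolutelyContinuousOnInterval k a b)
    (hCc : ∀ᵐ x, x ∈ uIcc a b → HasDerivAt C (c x) x)
    (hkκ : ∀ᵐ x, x ∈ uIcc a b → HasDerivAt k (κ x) x) :
    ∫ x in a..b, (Real.exp (C x) * c x * k x + Real.exp (C x) * κ x) =
      Real.exp (C b) * k b - Real.exp (C a) * k a := by
  rw [← (absolutelyContinuousOnInterval_exp hC).integral_deriv_mul_eq_sub hk]
  refine intervalIntegral.integral_congr_ae ?_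
  filter_upwards [hCc, hkκ] with x hCx hkx hx
  rw [(hCx (uIoc_subset_uIcc hx)).exp.deriv, (hkx (uIoc_subset_uIcc hx)).deriv]

theorem integral_exp_mul_deriv {C c : ℝ → ℝ} (hC : AbsolutelyContinuousOnInterval C a b)
    (hCc : ∀ᵐ x, x ∈ uIcc a b → HasDerivAt C (c x) x) :
    ∫ x in a..b, Real.exp (C x) * c x = Real.exp (C b) - Real.exp (C a) := by
  simpa using integral_exp_mul_deriv_add hC
    (contDiff_const (c := (1 : ℝ))).contDiffOn.absolutelyContinuousOnInterval hCc
    (Eventually.of_forall fun x _ => hasDerivAt_const x 1)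

/-- The integrand is `(e ^ C k)' + c e ^ C (f - k)`. -/
theorem integral_exp_mul_le {C c f k κ : ℝ → ℝ} (hab : a ≤ b)
    (hC : AbsolutelyContinuousOnInterval C a b) (hk : AbsolutelyContinuousOnInterval k a b)
    (hCc : ∀ᵐ x, x ∈ uIcc a b → HasDerivAt C (c x) x)
    (hkκ : ∀ᵐ x, x ∈ uIcc a b → HasDerivAt k (κ x) x)
    (hCa : C a = 0) (hf : ContinuousOn f (uIcc a b)) (hc : IntervalIntegrable c volume a b)
    (hκ : IntervalIntegrable κ volume a b) (hc0 : ∀ x ∈ Icc a b, 0 ≤ c x)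
    (hmax : ∀ x ∈ Icc a b, f x - k x ≤ f b - k b) :
    f a + ∫ x in a..b, Real.exp (C x) * (κ x + c x * f x) ≤ Real.exp (C b) * f b := by
  have hExp : ContinuousOn (fun x => Real.exp (C x)) (uIcc a b) :=
    Real.continuous_exp.comp_continuousOn hC.continuousOn
  have hEc : IntervalIntegrable (fun x => Real.exp (C x) * c x) volume a b :=
    hc.continuousOn_mul hExp
  have hEcf : IntervalIntegrable (fun x => Real.exp (C x) * c x * (f x - k x)) volume a b :=
    hEc.mul_continuousOn (hf.sub hk.continuousOn)
  have hsplit : ∫ x in a..b, Real.exp (C x) * (κ x + c x * f x) =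
      Real.exp (C b) * k b - k a + ∫ x in a..b, Real.exp (C x) * c x * (f x - k x) := by
    have hparts := integral_exp_mul_deriv_add hC hk hCc hkκ
    rw [hCa, Real.exp_zero, one_mul] at hparts
    rw [← hparts, ← intervalIntegral.integral_add
      ((hEc.mul_continuousOn hk.continuousOn).add (hκ.continuousOn_mul hExp)) hEcf]
    congr 1 with x
    ring
  have hle : ∫ x in a..b, Real.exp (C x) * c x * (f x - k x) ≤
      (Real.exp (C b) - 1) * (f b - k b) := by
    rw [← Real.exp_zero, ← hCa, ← integral_exp_mul_deriv hC hCc,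
      ← intervalIntegral.integral_mul_const]
    exact intervalIntegral.integral_mono_on hab hEcf (hEc.mul_const _) fun x hx =>
      mul_le_mul_of_nonneg_left (hmax x hx) (mul_nonneg (Real.exp_pos _).le (hc0 x hx))
  linarith [hmax a (left_mem_Icc.2 hab)]

theorem add_integral_le_exp_mul {f q c : ℝ → ℝ} (hab : a ≤ b)
    (hf : ContinuousOn f (Icc a b)) (hc : IntervalIntegrable c volume a b)
    (hq : IntervalIntegrable q volume a b) (hc0 : ∀ s ∈ Icc a b, 0 ≤ c s)
    (h : ∀ s ∈ Icc a b,
      ∫ r in s..b, (Real.exp (-∫ x in a..r, c x) * q r - c r * f r) ≤ f b - f s) :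
    f a + ∫ r in a..b, q r ≤ Real.exp (∫ x in a..b, c x) * f b := by
  set C : ℝ → ℝ := fun r => ∫ x in a..r, c x
  set κ : ℝ → ℝ := fun r => Real.exp (-C r) * q r - c r * f r with hκ_def
  rw [← uIcc_of_le hab] at hf
  have hC : AbsolutelyContinuousOnInterval C a b :=
    hc.absolutelyContinuousOnInterval_intervalIntegral left_mem_uIcc
  have hκ : IntervalIntegrable κ volume a b :=
    (hq.continuousOn_mul (Real.continuous_exp.comp_continuousOn hC.continuousOn.neg)).sub
      (hc.mul_continuousOn hf)
  have hmax : ∀ s ∈ Icc a b, f s - ∫ r in a..s, κ r ≤ f b - ∫ r in a..b, κ r := fun s hs => by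
    rw [← uIcc_of_le hab] at hs
    have hadd := intervalIntegral.integral_add_adjacent_intervals
      (hκ.mono_set (uIcc_subset_uIcc_left hs)) (hκ.mono_set (uIcc_subset_uIcc_right hs))
    linarith [h s (uIcc_of_le hab ▸ hs)]
  have hq_eq : ∀ x, Real.exp (C x) * (κ x + c x * f x) = q x := fun x => by
    simp only [hκ_def]
    rw [sub_add_cancel, ← mul_assoc, ← Real.exp_add, add_neg_cancel, Real.exp_zero, one_mul]
  have hderiv {g : ℝ → ℝ} (hg : IntervalIntegrable g volume a b) :
      ∀ᵐ x, x ∈ uIcc a b → HasDerivAt (fun r => ∫ x in a..r, g x) (g x) x := by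
    filter_upwards [hg.ae_hasDerivAt_integral] with x hx hxm using hx hxm a left_mem_uIcc
  simpa only [hq_eq] using integral_exp_mul_le hab hC
    (hκ.absolutelyContinuousOnInterval_intervalIntegral left_mem_uIcc) (hderiv hc) (hderiv hκ)
    intervalIntegral.integral_same hf hc hκ hc0 hmax

end LineIntegrals

/-! ### Self-adjoint operators `T ≥ I` -/

section UnboundedOperators

variable {H : Type*} [NormedAddCommGroup H] [InnerProductSpace ℂ H] {T : H →ₗ.[ℂ] H} {x y : H}

theorem ev_of_mem (h : x ∈ T.domain) : ev T x = T ⟨x, h⟩ := dif_pos h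

theorem ev_sub (hx : x ∈ T.domain) (hy : y ∈ T.domain) : ev T (x - y) = ev T x - ev T y := by
  rw [ev_of_mem hx, ev_of_mem hy, ev_of_mem (sub_mem hx hy), ← LinearPMap.map_sub]
  rfl

theorem mem_closure_of_hasCore {f : H →ₗ.[ℂ] H} {D : Submodule ℂ H} (h : f.HasCore D)
    (hx : x ∈ f.domain) : (x, ev f x) ∈ closure ((fun u => (u, ev f u)) '' (D : Set H)) := by
  have hgraph : ((f.domRestrict D).graph : Set (H × H)) ⊆
      (fun u => (u, ev f u)) '' (D : Set H) := by
    rintro ⟨u, v⟩ hu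
    obtain ⟨⟨z, hz⟩, rfl, rfl⟩ := (LinearPMap.mem_graph_iff _).1 hu
    obtain ⟨hzD, hzf⟩ := Submodule.mem_inf.1 hz
    exact ⟨z, hzD, Prod.ext rfl ((ev_of_mem hzf).trans (LinearPMap.domRestrict_apply rfl).symm)⟩
  refine closure_mono hgraph ?_
  have hmem : (x, ev f x) ∈ (f.domRestrict D).closure.graph := by
    rw [h.closure_eq, ev_of_mem hx]
    exact f.mem_graph ⟨x, hx⟩
  by_cases hc : (f.domRestrict D).IsClosable
  · rwa [← hc.graph_closure_eq_closure_graph] at hmem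
  · rw [LinearPMap.closure_def' hc] at hmem
    exact subset_closure hmem

theorem dense_of_hasCore {f : H →ₗ.[ℂ] H} {D : Submodule ℂ H} (h : f.HasCore D)
    (hf : Dense (f.domain : Set H)) : Dense (D : Set H) := by
  refine dense_closure.1 (hf.mono fun x hx => ?_)
  have := mem_closure_image (continuous_fst.continuousAt) (mem_closure_of_hasCore h hx)
  rwa [image_image, image_id'] at this

theorem re_inner_le_of_hasCore {f : H →ₗ.[ℂ] H} {D : Submodule ℂ H} (h : f.HasCore D)
    {X : H →L[ℂ] H} {a : ℝ} (hX : ∀ ψ ∈ D, (⟪ψ, X ψ⟫_ℂ).re ≤ a * ‖ev f ψ‖ ^ 2)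
    (hx : x ∈ f.domain) : (⟪x, X x⟫_ℂ).re ≤ a * ‖ev f x‖ ^ 2 := by
  have hclosed : IsClosed {p : H × H | (⟪p.1, X p.1⟫_ℂ).re ≤ a * ‖p.2‖ ^ 2} :=
    isClosed_le (by fun_prop) (by fun_prop)
  exact closure_minimal (forall_mem_image.2 hX) hclosed (mem_closure_of_hasCore h hx)

variable [CompleteSpace H]

theorem inner_ev_left (hT : IsSelfAdjoint T) (hx : x ∈ T.domain) (hy : y ∈ T.domain) :
    ⟪ev T x, y⟫_ℂ = ⟪x, ev T y⟫_ℂ := by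
  have h := LinearPMap.adjoint_isFormalAdjoint hT.dense_domain
  rw [LinearPMap.isSelfAdjoint_def.1 hT] at h
  rw [ev_of_mem hx, ev_of_mem hy]
  exact h ⟨x, hx⟩ ⟨y, hy⟩

theorem mem_graph_zero_of_forall_inner_eq_zero (hT : IsSelfAdjoint T)
    (hy : ∀ x : T.domain, ⟪T x, y⟫_ℂ = 0) : (y, (0 : H)) ∈ T.graph := by
  rw [← LinearPMap.isSelfAdjoint_def.1 hT,
    LinearPMap.adjoint_graph_eq_graph_adjoint hT.dense_domain, Submodule.mem_adjoint_iff]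
  intro a b hab
  obtain ⟨x, -, rfl⟩ := (LinearPMap.mem_graph_iff _).1 hab
  rw [hy x, inner_zero_right, sub_zero]

/-- Convexity of the form of a positive operator: it lies above its tangents. -/
theorem re_inner_add_two_mul_le (hT : IsSelfAdjoint T)
    (hpos : ∀ z ∈ T.domain, 0 ≤ (⟪z, ev T z⟫_ℂ).re) (hx : x ∈ T.domain) (hy : y ∈ T.domain) :
    (⟪x, ev T x⟫_ℂ).re + 2 * (⟪y - x, ev T x⟫_ℂ).re ≤ (⟪y, ev T y⟫_ℂ).re := by
  have h := hpos _ (sub_mem hy hx)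
  have hsymm : (⟪x, ev T y⟫_ℂ).re = (⟪y, ev T x⟫_ℂ).re := by
    rw [← inner_ev_left hT hx hy, ← inner_conj_symm, Complex.conj_re]
  simp only [ev_sub hy hx, inner_sub_left, inner_sub_right, Complex.sub_re] at h ⊢
  linarith

theorem mem_domain_sqrtOp : x ∈ (sqrtOp T).domain ↔ x ∈ range (invSqrt T) := by
  rw [sqrtOp, LinearPMap.inverse_domain]
  exact ⟨fun ⟨y, hy⟩ => ⟨y, hy⟩, fun ⟨y, hy⟩ => ⟨⟨y, trivial⟩, hy⟩⟩

namespace IsSelfAdjointGeOne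

theorem norm_le (hT : IsSelfAdjointGeOne T) (x : T.domain) : ‖(x : H)‖ ≤ ‖T x‖ := by
  have h := (hT.one_le x).trans
    ((Complex.re_le_norm _).trans (norm_inner_le_norm (𝕜 := ℂ) (x : H) (T x)))
  rcases (norm_nonneg (x : H)).eq_or_lt with h0 | h0
  · exact h0 ▸ norm_nonneg _
  · exact le_of_mul_le_mul_left (by rwa [← sq]) h0

theorem isClosed_range (hT : IsSelfAdjointGeOne T) : IsClosed (range T) := by
  let snd : T.graph → H := fun p => (p : H × H).2
  have hrange : range T = range snd := by
    ext y
    constructor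
    · rintro ⟨x, rfl⟩
      exact ⟨⟨_, T.mem_graph x⟩, rfl⟩
    · rintro ⟨⟨p, hp⟩, rfl⟩
      obtain ⟨x, -, hx⟩ := (LinearPMap.mem_graph_iff _).1 hp
      exact ⟨x, hx⟩
  have hanti : AntilipschitzWith 1 snd := AntilipschitzWith.of_le_mul_dist fun p q => by
    obtain ⟨x, hx, hTx⟩ := (LinearPMap.mem_graph_iff _).1 (p - q).2
    have hnorm : ‖((p - q : T.graph) : H × H)‖ ≤ ‖((p - q : T.graph) : H × H).2‖ :=
      max_le (by rw [← hx, ← hTx]; exact hT.norm_le x) le_rfl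
    rw [NNReal.coe_one, one_mul, dist_eq_norm, dist_eq_norm]
    exact hnorm
  have : CompleteSpace T.graph := hT.isSelfAdjoint.isClosed.completeSpace_coe
  rw [hrange]
  exact hanti.isClosed_range (uniformContinuous_snd.comp uniformContinuous_subtype_val)

theorem surjective (hT : IsSelfAdjointGeOne T) : Function.Surjective T := by
  have hperp : (LinearMap.range T.toFun)ᗮ = ⊥ := by
    refine (Submodule.eq_bot_iff _).2 fun y hy => ?_
    obtain ⟨z, rfl, hz⟩ := (LinearPMap.mem_graph_iff _).1 <|
      mem_graph_zero_of_forall_inner_eq_zero hT.isSelfAdjoint fun x =>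
        (Submodule.mem_orthogonal _ _).1 hy _ ⟨x, rfl⟩
    exact norm_le_zero_iff.1 ((hT.norm_le z).trans (by rw [hz, norm_zero]))
  have htop := (Submodule.topologicalClosure_eq_top_iff).2 hperp
  rw [IsClosed.submodule_topologicalClosure_eq hT.isClosed_range] at htop
  exact LinearMap.range_eq_top.1 htop

theorem exists_isInverse (hT : IsSelfAdjointGeOne T) : ∃ R, IsInverse T R := by
  have hinj : Function.Injective T := (injective_iff_map_eq_zero T.toFun).2 fun x hx =>
    Subtype.ext (norm_le_zero_iff.1 ((hT.norm_le x).trans (hx ▸ norm_zero).le))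
  let e : T.domain ≃ₗ[ℂ] H := LinearEquiv.ofBijective T.toFun ⟨hinj, hT.surjective⟩
  have hTe (y : H) : T (e.symm y) = y := e.apply_symm_apply y
  let R : H →L[ℂ] H := (T.domain.subtype ∘ₗ e.symm.toLinearMap).mkContinuous 1 fun y => by
    simpa [hTe] using hT.norm_le (e.symm y)
  exact ⟨R, fun y => ⟨(e.symm y).2, hTe y⟩, fun x => congrArg Subtype.val (e.symm_apply_apply x)⟩

theorem isInverse_inv (hT : IsSelfAdjointGeOne T) : IsInverse T (inv T) := by
  rw [inv, dif_pos hT.exists_isInverse]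
  exact hT.exists_isInverse.choose_spec

theorem inv_nonneg (hT : IsSelfAdjointGeOne T) : 0 ≤ inv T := by
  rw [ContinuousLinearMap.nonneg_iff_isPositive, ContinuousLinearMap.isPositive_def',
    ContinuousLinearMap.isSelfAdjoint_iff_isSymmetric]
  refine ⟨fun x y => ?_, fun y => ?_⟩
  · obtain ⟨hx, hTx⟩ := hT.isInverse_inv.1 x
    obtain ⟨hy, hTy⟩ := hT.isInverse_inv.1 y
    have h := inner_ev_left hT.isSelfAdjoint hx hy
    rw [ev_of_mem hx, ev_of_mem hy, hTx, hTy] at h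
    exact h.symm
  · obtain ⟨hy, hTy⟩ := hT.isInverse_inv.1 y
    have h := hT.one_le ⟨_, hy⟩
    rw [hTy] at h
    exact (sq_nonneg _).trans h

theorem invSqrt_invSqrt (hT : IsSelfAdjointGeOne T) (x : H) :
    invSqrt T (invSqrt T x) = inv T x :=
  DFunLike.congr_fun (CFC.sqrt_mul_sqrt_self (inv T) hT.inv_nonneg) x

theorem invSqrt_invSqrt_apply (hT : IsSelfAdjointGeOne T) (x : T.domain) :
    invSqrt T (invSqrt T (T x)) = x := by
  rw [hT.invSqrt_invSqrt, hT.isInverse_inv.2 x]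

theorem invSqrt_injective (hT : IsSelfAdjointGeOne T) : Function.Injective (invSqrt T) := by
  intro x y hxy
  obtain ⟨hx, hTx⟩ := hT.isInverse_inv.1 x
  obtain ⟨hy, hTy⟩ := hT.isInverse_inv.1 y
  rw [← hTx, ← hTy]
  congr 2
  rw [← hT.invSqrt_invSqrt, hxy, hT.invSqrt_invSqrt]

theorem ev_sqrtOp_invSqrt (hT : IsSelfAdjointGeOne T) (x : H) :
    ev (sqrtOp T) (invSqrt T x) = x := by
  rw [ev_of_mem (mem_domain_sqrtOp.2 ⟨x, rfl⟩)]
  have hker : LinearMap.ker (((invSqrt T : H →L[ℂ] H) : H →ₗ[ℂ] H).toPMap ⊤).toFun = ⊥ :=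
    LinearMap.ker_eq_bot.2 fun _ _ h => Subtype.ext (hT.invSqrt_injective h)
  exact LinearPMap.inverse_apply_eq hker (x := ⟨x, trivial⟩) rfl

theorem domain_le_domain_sqrtOp (hT : IsSelfAdjointGeOne T) : T.domain ≤ (sqrtOp T).domain :=
  fun x hx => by
    simpa only [hT.invSqrt_invSqrt_apply] using
      (mem_domain_sqrtOp (T := T)).2 ⟨invSqrt T (T ⟨x, hx⟩), rfl⟩

theorem inner_ev (hT : IsSelfAdjointGeOne T) (hx : x ∈ T.domain) :
    ⟪x, ev T x⟫_ℂ = ((‖ev (sqrtOp T) x‖ ^ 2 : ℝ) : ℂ) := by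
  obtain ⟨y, hy⟩ : ∃ y, y = T ⟨x, hx⟩ := ⟨_, rfl⟩
  have hsymm := ContinuousLinearMap.isSelfAdjoint_iff_isSymmetric.1
    (IsSelfAdjoint.of_nonneg (CFC.sqrt_nonneg (inv T)))
  have hxy : invSqrt T (invSqrt T y) = x := hy ▸ hT.invSqrt_invSqrt_apply ⟨x, hx⟩
  rw [ev_of_mem hx, ← hy, ← hxy, hT.ev_sqrtOp_invSqrt, Complex.ofReal_pow]
  exact (hsymm (invSqrt T y) y).trans (inner_self_eq_norm_sq_to_K _)

end IsSelfAdjointGeOne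

end UnboundedOperators

/-! ### Sesquilinear forms -/

section SesquilinearForms

open Complex (I)

variable {E : Type*}

theorem sesq_polarization [AddCommGroup E] [Module ℂ E] (Q : E →ₗ⋆[ℂ] E →ₗ[ℂ] ℂ) (φ ψ : E) :
    Q φ ψ = (Q (φ + ψ) (φ + ψ) - Q (φ - ψ) (φ - ψ)
      - I * Q (φ + I • ψ) (φ + I • ψ) + I * Q (φ - I • ψ) (φ - I • ψ)) / 4 := by
  simp only [map_add, map_sub, map_smul, LinearMap.map_smulₛₗ, LinearMap.add_apply,
    LinearMap.sub_apply, LinearMap.smul_apply, smul_eq_mul, Complex.conj_I]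
  linear_combination (Q φ ψ - Q ψ φ) / 2 * Complex.I_sq

theorem exists_tendsto_sesq [AddCommGroup E] [Module ℂ E] {ι : Type*} {l : Filter ι} [l.NeBot]
    {Q : ι → E →ₗ⋆[ℂ] E →ₗ[ℂ] ℂ} (h : ∀ ψ, ∃ a, Tendsto (fun n => Q n ψ ψ) l (𝓝 a)) :
    ∃ R : E →ₗ⋆[ℂ] E →ₗ[ℂ] ℂ, ∀ ψ, Tendsto (fun n => Q n ψ ψ) l (𝓝 (R ψ ψ)) := by
  choose a ha using h
  have hQ : ∀ φ ψ, ∃ b, Tendsto (fun n => Q n φ ψ) l (𝓝 b) := fun φ ψ =>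
    ⟨_, ((((ha (φ + ψ)).sub (ha (φ - ψ))).sub ((ha (φ + I • ψ)).const_mul I)).add
      ((ha (φ - I • ψ)).const_mul I)).div_const 4 |>.congr fun n =>
        (sesq_polarization (Q n) φ ψ).symm⟩
  choose q hq using hQ
  refine ⟨LinearMap.mk₂'ₛₗ (starRingEnd ℂ) (RingHom.id ℂ) q (fun φ φ' ψ => ?_) (fun z φ ψ => ?_)
    (fun φ ψ ψ' => ?_) (fun z φ ψ => ?_), fun ψ => hq ψ ψ⟩
  · exact tendsto_nhds_unique (hq _ ψ) (((hq φ ψ).add (hq φ' ψ)).congr fun n => by simp)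
  · exact tendsto_nhds_unique (hq _ ψ) (((hq φ ψ).const_smul _).congr fun n => by simp)
  · exact tendsto_nhds_unique (hq φ _) (((hq φ ψ).add (hq φ ψ')).congr fun n => by simp)
  · exact tendsto_nhds_unique (hq φ _) (((hq φ ψ).const_smul _).congr fun n => by simp)

theorem exists_integral_sesq [AddCommGroup E] [Module ℂ E] {α : Type*} [MeasurableSpace α]
    {μ : Measure α} {Q : α → E →ₗ⋆[ℂ] E →ₗ[ℂ] ℂ} (h : ∀ ψ, Integrable (fun s => Q s ψ ψ) μ) :
    ∃ R : E →ₗ⋆[ℂ] E →ₗ[ℂ] ℂ, ∀ ψ, R ψ ψ = ∫ s, Q s ψ ψ ∂μ := by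
  have hQ : ∀ φ ψ, Integrable (fun s => Q s φ ψ) μ := fun φ ψ => by
    simp only [fun s => sesq_polarization (Q s) φ ψ]
    exact ((((h _).sub (h _)).sub ((h _).const_mul I)).add ((h _).const_mul I)).div_const 4
  refine ⟨LinearMap.mk₂'ₛₗ (starRingEnd ℂ) (RingHom.id ℂ) (fun φ ψ => ∫ s, Q s φ ψ ∂μ)
    (fun φ φ' ψ => ?_) (fun z φ ψ => ?_) (fun φ ψ ψ' => ?_) (fun z φ ψ => ?_), fun ψ => rfl⟩
  · simp only [map_add, LinearMap.add_apply, integral_add (hQ φ ψ) (hQ φ' ψ)]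
  · simp only [LinearMap.map_smulₛₗ, LinearMap.smul_apply, integral_smul]
  · simp only [map_add, integral_add (hQ φ ψ) (hQ φ ψ')]
  · simp only [map_smul, integral_smul, RingHom.id_apply]

variable [NormedAddCommGroup E] [InnerProductSpace ℂ E] {Q : E →ₗ⋆[ℂ] E →ₗ[ℂ] ℂ} {C : ℝ}

theorem norm_sesq_le_add_sq (hQ : ∀ ψ, ‖Q ψ ψ‖ ≤ C * ‖ψ‖ ^ 2) (φ ψ : E) :
    ‖Q φ ψ‖ ≤ C * (‖φ‖ ^ 2 + ‖ψ‖ ^ 2) := by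
  have hnorm : 4 * ‖Q φ ψ‖ ≤ ‖Q (φ + ψ) (φ + ψ)‖ + ‖Q (φ - ψ) (φ - ψ)‖
      + ‖Q (φ + I • ψ) (φ + I • ψ)‖ + ‖Q (φ - I • ψ) (φ - I • ψ)‖ := by
    rw [sesq_polarization Q φ ψ, norm_div, Complex.norm_ofNat, mul_div_cancel₀ _ four_ne_zero]
    refine (norm_add_le _ _).trans (add_le_add ((norm_sub_le _ _).trans
      (add_le_add (norm_sub_le _ _) ?_)) ?_) <;> rw [norm_mul, Complex.norm_I, one_mul]
  have h₁ := parallelogram_law_with_norm ℂ φ ψ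
  have h₂ := parallelogram_law_with_norm ℂ φ (I • ψ)
  rw [norm_smul, Complex.norm_I, one_mul] at h₂
  have hsum : C * ‖φ + ψ‖ ^ 2 + C * ‖φ - ψ‖ ^ 2 + C * ‖φ + I • ψ‖ ^ 2 + C * ‖φ - I • ψ‖ ^ 2 =
      4 * (C * (‖φ‖ ^ 2 + ‖ψ‖ ^ 2)) := by
    linear_combination C * h₁ + C * h₂
  linarith [hQ (φ + ψ), hQ (φ - ψ), hQ (φ + I • ψ), hQ (φ - I • ψ)]

theorem norm_sesq_le (hQ : ∀ ψ, ‖Q ψ ψ‖ ≤ C * ‖ψ‖ ^ 2) (φ ψ : E) :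
    ‖Q φ ψ‖ ≤ 2 * C * ‖φ‖ * ‖ψ‖ := by
  rcases eq_or_ne φ 0 with rfl | hφ
  · simp
  rcases eq_or_ne ψ 0 with rfl | hψ
  · simp
  have hφ' : ‖φ‖ ≠ 0 := norm_ne_zero_iff.2 hφ
  have hψ' : ‖ψ‖ ≠ 0 := norm_ne_zero_iff.2 hψ
  have hunit := norm_sesq_le_add_sq hQ (((‖φ‖⁻¹ : ℝ) : ℂ) • φ) (((‖ψ‖⁻¹ : ℝ) : ℂ) • ψ)
  simp only [LinearMap.map_smulₛₗ, LinearMap.smul_apply, smul_eq_mul, norm_mul, norm_smul,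
    Complex.conj_ofReal, map_smul, Complex.norm_real, norm_inv, norm_norm,
    inv_mul_cancel₀ hφ', inv_mul_cancel₀ hψ'] at hunit
  calc ‖Q φ ψ‖ = ‖ψ‖⁻¹ * (‖φ‖⁻¹ * ‖Q φ ψ‖) * (‖φ‖ * ‖ψ‖) := by field_simp
    _ ≤ C * (1 ^ 2 + 1 ^ 2) * (‖φ‖ * ‖ψ‖) := by gcongr
    _ = 2 * C * ‖φ‖ * ‖ψ‖ := by ring

variable {H : Type*} [NormedAddCommGroup H] [InnerProductSpace ℂ H] [CompleteSpace H]
  {e : E →ₗᵢ[ℂ] H}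

theorem exists_inner_eq (he : DenseRange e) {ℓ : E →ₗ[ℂ] ℂ} {K : ℝ} (hK : 0 ≤ K)
    (hℓ : ∀ ψ, ‖ℓ ψ‖ ≤ K * ‖ψ‖) : ∃ v : H, ‖v‖ ≤ K ∧ ∀ ψ, ⟪v, e ψ⟫_ℂ = ℓ ψ := by
  have hℓ' : ∀ ψ, ‖ℓ ψ‖ ≤ K * ‖e.toLinearMap ψ‖ := fun ψ => by simpa using hℓ ψ
  refine ⟨(InnerProductSpace.toDual ℂ H).symm (ℓ.extendOfNorm e.toLinearMap), ?_, fun ψ => ?_⟩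
  · rw [LinearIsometryEquiv.norm_map]
    exact LinearMap.opNorm_extendOfNorm_le he hK hℓ'
  · rw [InnerProductSpace.toDual_symm_apply]
    exact LinearMap.extendOfNorm_eq he ⟨K, hℓ'⟩ ψ

theorem exists_operator_of_sesq (he : DenseRange e) (hC : 0 ≤ C)
    (hQ : ∀ ψ, ‖Q ψ ψ‖ ≤ C * ‖ψ‖ ^ 2) : ∃ T : H →L[ℂ] H, ∀ φ ψ, ⟪e φ, T (e ψ)⟫_ℂ = Q φ ψ := by
  choose v hv hvQ using fun φ =>
    exists_inner_eq he (mul_nonneg (mul_nonneg zero_le_two hC) (norm_nonneg φ)) (norm_sesq_le hQ φ)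
  have hext : ∀ x y : H, (∀ ψ, ⟪x, e ψ⟫_ℂ = ⟪y, e ψ⟫_ℂ) → x = y := fun x y h =>
    Dense.eq_of_inner_left ℂ he (forall_mem_range.2 h)
  let S : E →ₗ[ℂ] H :=
    { toFun := v
      map_add' := fun φ φ' => hext _ _ fun ψ => by
        rw [inner_add_left, hvQ, hvQ, hvQ, map_add, LinearMap.add_apply]
      map_smul' := fun z φ => hext _ _ fun ψ => by
        rw [RingHom.id_apply, inner_smul_left, hvQ, hvQ, LinearMap.map_smulₛₗ,
          LinearMap.smul_apply, smul_eq_mul] }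
  have hS : ∀ φ, S.extendOfNorm e.toLinearMap (e φ) = v φ :=
    LinearMap.extendOfNorm_eq he ⟨2 * C, fun φ => (hv φ).trans_eq (by simp)⟩
  refine ⟨ContinuousLinearMap.adjoint (S.extendOfNorm e.toLinearMap), fun φ ψ => ?_⟩
  rw [ContinuousLinearMap.adjoint_inner_right, hS, hvQ]

end SesquilinearForms

/-! ### The order on bounded operators -/

section BoundedOperators

open scoped ComplexOrder ComplexStarModule

variable {H : Type*} [NormedAddCommGroup H] [InnerProductSpace ℂ H] {X Y : H →L[ℂ] H}

/-- The pull-back `(φ, ψ) ↦ ⟪ℓ φ, X (ℓ ψ)⟫` along a linear map `ℓ` of the sesquilinear form of a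
bounded operator `X`. -/
def operatorForm {E : Type*} [AddCommGroup E] [Module ℂ E] (ℓ : E →ₗ[ℂ] H) (X : H →L[ℂ] H) :
    E →ₗ⋆[ℂ] E →ₗ[ℂ] ℂ :=
  ((innerₛₗ ℂ).comp ℓ).compl₂ (X.toLinearMap ∘ₗ ℓ)

theorem operatorForm_apply {E : Type*} [AddCommGroup E] [Module ℂ E] (ℓ : E →ₗ[ℂ] H)
    (X : H →L[ℂ] H) (φ ψ : E) : operatorForm ℓ X φ ψ = ⟪ℓ φ, X (ℓ ψ)⟫_ℂ := rfl

theorem re_inner_nonneg (hX : 0 ≤ X) (x : H) : 0 ≤ (⟪x, X x⟫_ℂ).re :=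
  ((ContinuousLinearMap.nonneg_iff_isPositive X).1 hX).re_inner_nonneg_right x

theorem inner_mono (h : X ≤ Y) (x : H) : ⟪x, X x⟫_ℂ ≤ ⟪x, Y x⟫_ℂ := by
  have := (ContinuousLinearMap.le_def X Y).1 h |>.inner_nonneg_right x
  rwa [sub_apply, inner_sub_right, sub_nonneg] at this

theorem re_inner_mono (h : X ≤ Y) (x : H) : (⟪x, X x⟫_ℂ).re ≤ (⟪x, Y x⟫_ℂ).re :=
  (Complex.le_def.1 (inner_mono h x)).1

theorem le_of_forall_inner_le {D : Set H} (hD : Dense D)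
    (h : ∀ ψ ∈ D, ⟪ψ, X ψ⟫_ℂ ≤ ⟪ψ, Y ψ⟫_ℂ) : X ≤ Y := by
  have hclosed : IsClosed {ψ : H | ⟪ψ, X ψ⟫_ℂ ≤ ⟪ψ, Y ψ⟫_ℂ} :=
    isClosed_le (by fun_prop) (by fun_prop)
  have hall : ∀ ψ, 0 ≤ ⟪ψ, (Y - X) ψ⟫_ℂ := fun ψ => by
    rw [sub_apply, inner_sub_right, sub_nonneg]
    exact hclosed.closure_subset_iff.2 h (hD ψ)
  rw [ContinuousLinearMap.le_def, ContinuousLinearMap.isPositive_iff_complex]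
  intro ψ
  have hreal := Complex.nonneg_iff.1 (hall ψ)
  rw [← inner_conj_symm ((Y - X) ψ) ψ, RCLike.re_to_complex, Complex.conj_re]
  exact ⟨Complex.ext rfl (by rw [Complex.conj_im, ← hreal.2, neg_zero]; rfl), hreal.1⟩

theorem eq_of_forall_inner_eq {D : Set H} (hD : Dense D)
    (h : ∀ ψ ∈ D, ⟪ψ, X ψ⟫_ℂ = ⟪ψ, Y ψ⟫_ℂ) : X = Y :=
  le_antisymm (le_of_forall_inner_le hD fun ψ hψ => (h ψ hψ).le)
    (le_of_forall_inner_le hD fun ψ hψ => (h ψ hψ).ge)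

theorem opNorm_le_of_forall_norm_inner_le {D : Set H} (hD : Dense D) {C : ℝ} (hC : 0 ≤ C)
    (h : ∀ ψ ∈ D, ‖⟪ψ, X ψ⟫_ℂ‖ ≤ C * ‖ψ‖ ^ 2) : ‖X‖ ≤ 2 * C := by
  have hclosed : IsClosed {ψ : H | ‖⟪ψ, X ψ⟫_ℂ‖ ≤ C * ‖ψ‖ ^ 2} :=
    isClosed_le (by fun_prop) (by fun_prop)
  have hform : ∀ φ ψ, ‖⟪φ, X ψ⟫_ℂ‖ ≤ 2 * C * ‖φ‖ * ‖ψ‖ :=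
    norm_sesq_le (Q := operatorForm LinearMap.id X) fun ψ => hclosed.closure_subset_iff.2 h (hD ψ)
  refine X.opNorm_le_bound (by positivity) fun ψ => ?_
  rcases (norm_nonneg (X ψ)).eq_or_lt with h0 | h0
  · rw [← h0]
    positivity
  · refine le_of_mul_le_mul_left ?_ h0
    calc ‖X ψ‖ * ‖X ψ‖ = ‖⟪X ψ, X ψ⟫_ℂ‖ := by
          rw [← inner_self_re_eq_norm, inner_self_eq_norm_mul_norm]
      _ ≤ 2 * C * ‖X ψ‖ * ‖ψ‖ := hform _ _
      _ = ‖X ψ‖ * (2 * C * ‖ψ‖) := by ring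

theorem inner_opOfForm {D : Submodule ℂ H} {q : H → ℂ}
    (h : ∃ T : H →L[ℂ] H, ∀ ψ ∈ D, ⟪ψ, T ψ⟫_ℂ = q ψ) {ψ : H} (hψ : ψ ∈ D) :
    ⟪ψ, opOfForm D q ψ⟫_ℂ = q ψ := by
  rw [opOfForm, dif_pos h]
  exact h.choose_spec ψ hψ

variable [CompleteSpace H]

theorem coe_re_inner_of_isSelfAdjoint (hX : IsSelfAdjoint X) (x : H) :
    ((⟪x, X x⟫_ℂ).re : ℂ) = ⟪x, X x⟫_ℂ :=
  (ContinuousLinearMap.isSelfAdjoint_iff_isSymmetric.1 hX).coe_re_inner_self_apply x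

/-- Vigier's theorem for sequences: the least upper bound is the weak limit. -/
theorem exists_isLUB_tendsto_of_monotone {X : ℕ → H →L[ℂ] H} (hmono : Monotone X)
    (h0 : ∀ n, 0 ≤ X n) {C : ℝ} (hC : 0 ≤ C) (hXC : ∀ n ψ, (⟪ψ, X n ψ⟫_ℂ).re ≤ C * ‖ψ‖ ^ 2) :
    ∃ T, IsLUB (range X) T ∧ ∀ ψ, Tendsto (fun n => ⟪ψ, X n ψ⟫_ℂ) atTop (𝓝 ⟪ψ, T ψ⟫_ℂ) := by
  have hreal n ψ := coe_re_inner_of_isSelfAdjoint (IsSelfAdjoint.of_nonneg (h0 n)) ψ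
  obtain ⟨R, hR⟩ := exists_tendsto_sesq (Q := fun n => operatorForm LinearMap.id (X n))
    (l := atTop) fun ψ => by
      have hsup := tendsto_atTop_ciSup (f := fun n => (⟪ψ, X n ψ⟫_ℂ).re)
        (fun m n hmn => re_inner_mono (hmono hmn) ψ)
        ⟨C * ‖ψ‖ ^ 2, forall_mem_range.2 fun n => hXC n ψ⟩
      exact ⟨_, ((Complex.continuous_ofReal.tendsto _).comp hsup).congr fun n => hreal n ψ⟩
  have hRC : ∀ ψ, ‖R ψ ψ‖ ≤ C * ‖ψ‖ ^ 2 := fun ψ =>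
    le_of_tendsto (hR ψ).norm <| Eventually.of_forall fun n => by
      rw [operatorForm_apply, LinearMap.id_apply, ← hreal, Complex.norm_real,
        Real.norm_of_nonneg (re_inner_nonneg (h0 n) ψ)]
      exact hXC n ψ
  obtain ⟨T, hT⟩ := exists_operator_of_sesq (e := LinearIsometry.id) denseRange_id hC hRC
  have hlim : ∀ ψ, Tendsto (fun n => ⟪ψ, X n ψ⟫_ℂ) atTop (𝓝 ⟪ψ, T ψ⟫_ℂ) := fun ψ =>
    (hT ψ ψ).symm ▸ hR ψ
  refine ⟨T, ⟨forall_mem_range.2 fun n => ?_, fun Y hY => ?_⟩, hlim⟩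
  · refine le_of_forall_inner_le dense_univ fun ψ _ => ge_of_tendsto (hlim ψ) ?_
    filter_upwards [eventually_ge_atTop n] with m hm using inner_mono (hmono hm) ψ
  · exact le_of_forall_inner_le dense_univ fun ψ _ =>
      le_of_tendsto' (hlim ψ) fun n => inner_mono (hY ⟨n, rfl⟩) ψ

variable {𝒜 : Type*} [CStarAlgebra 𝒜] [PartialOrder 𝒜] [StarOrderedRing 𝒜]

theorem norm_inner_apply_le_of_isSelfAdjoint (A : 𝒜 →ₚ[ℂ] (H →L[ℂ] H)) {a : 𝒜}
    (ha : IsSelfAdjoint a) (u : H) : ‖⟪u, A a u⟫_ℂ‖ ≤ ‖a‖ * (⟪u, A 1 u⟫_ℂ).re := by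
  have hscalar : A (algebraMap ℝ 𝒜 ‖a‖) = (‖a‖ : ℂ) • A 1 := by
    rw [Algebra.algebraMap_eq_smul_one, ← map_smul, Complex.coe_smul]
  have hle : A a ≤ (‖a‖ : ℂ) • A 1 :=
    hscalar ▸ OrderHomClass.mono A ha.le_algebraMap_norm_self
  have hge : -((‖a‖ : ℂ) • A 1) ≤ A a := by
    rw [← hscalar, ← map_neg]
    exact OrderHomClass.mono A ha.neg_algebraMap_norm_le_self
  rw [← coe_re_inner_of_isSelfAdjoint (ha.map A) u, Complex.norm_real, Real.norm_eq_abs, abs_le]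
  have h₁ := re_inner_mono hle u
  have h₂ := re_inner_mono hge u
  rw [neg_apply, smul_apply, inner_neg_right, inner_smul_right, Complex.neg_re,
    Complex.re_ofReal_mul] at h₂
  rw [smul_apply, inner_smul_right, Complex.re_ofReal_mul] at h₁
  exact ⟨h₂, h₁⟩

theorem norm_inner_apply_le (A : 𝒜 →ₚ[ℂ] (H →L[ℂ] H)) (a : 𝒜) (u : H) :
    ‖⟪u, A a u⟫_ℂ‖ ≤ 2 * ‖a‖ * (⟪u, A 1 u⟫_ℂ).re := by
  have h1 : 0 ≤ (⟪u, A 1 u⟫_ℂ).re := re_inner_nonneg (A.map_nonneg zero_le_one) u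
  calc ‖⟪u, A a u⟫_ℂ‖ = ‖⟪u, A (ℜ a) u⟫_ℂ + Complex.I * ⟪u, A (ℑ a) u⟫_ℂ‖ := by
        conv_lhs => rw [← realPart_add_I_smul_imaginaryPart a]
        rw [map_add, map_smul, add_apply, smul_apply, inner_add_right, inner_smul_right]
    _ ≤ ‖⟪u, A (ℜ a) u⟫_ℂ‖ + ‖⟪u, A (ℑ a) u⟫_ℂ‖ := by
        refine (norm_add_le _ _).trans_eq ?_
        rw [norm_mul, Complex.norm_I, one_mul]
    _ ≤ ‖a‖ * (⟪u, A 1 u⟫_ℂ).re + ‖a‖ * (⟪u, A 1 u⟫_ℂ).re := by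
        gcongr
        · exact (norm_inner_apply_le_of_isSelfAdjoint A (ℜ a).2 u).trans
            (mul_le_mul_of_nonneg_right (realPart.norm_le a) h1)
        · exact (norm_inner_apply_le_of_isSelfAdjoint A (ℑ a).2 u).trans
            (mul_le_mul_of_nonneg_right (imaginaryPart.norm_le a) h1)
    _ = 2 * ‖a‖ * (⟪u, A 1 u⟫_ℂ).re := by ring

end BoundedOperators

/-! ### Weak measurability -/

section WeakMeasurability

variable {H : Type*} [NormedAddCommGroup H] [InnerProductSpace ℂ H]
  {α : Type*} [MeasurableSpace α] {Y : α → H →L[ℂ] H}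

/-- Measurability of an operator-valued function in the weak operator topology. -/
def WeaklyMeasurable (Y : α → H →L[ℂ] H) : Prop :=
  ∀ x y, Measurable fun a => ⟪x, Y a y⟫_ℂ

theorem weaklyMeasurable_of_dense {D : Set H} (hD : Dense D)
    (h : ∀ ψ ∈ D, Measurable fun a => ⟪ψ, Y a ψ⟫_ℂ) : WeaklyMeasurable Y := by
  have hdiag : ∀ x, Measurable fun a => ⟪x, Y a x⟫_ℂ := by
    intro x
    obtain ⟨u, hu, hlim⟩ := mem_closure_iff_seq_limit.1 (hD x)
    refine measurable_of_tendsto_metrizable (fun n => h (u n) (hu n))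
      (tendsto_pi_nhds.2 fun a => ?_)
    have hc : Continuous fun v : H => ⟪v, Y a v⟫_ℂ := by fun_prop
    exact (hc.tendsto x).comp hlim
  intro x y
  have hpol := fun a => sesq_polarization (operatorForm LinearMap.id (Y a)) x y
  simp only [operatorForm_apply, LinearMap.id_apply] at hpol
  simp_rw [hpol]
  fun_prop (disch := exact hdiag _)

/-- The functional `X ↦ ⟪u, X v⟫`. -/
def vectorFunctional (u v : H) : (H →L[ℂ] H) →ₗ[ℂ] ℂ where
  toFun X := ⟪u, X v⟫_ℂ
  map_add' X Y := by rw [add_apply, inner_add_right]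
  map_smul' a X := by rw [smul_apply, inner_smul_right]; rfl

theorem isUltraweak_vectorFunctional (u v : H) : IsUltraweak (vectorFunctional u v) := by
  have hsum (w : H) : Summable fun n : ℕ => ‖(Pi.single 0 w : ℕ → H) n‖ ^ 2 :=
    summable_of_ne_finset_zero (s := {0}) fun n hn => by simp [Finset.mem_singleton.not.1 hn]
  refine ⟨Pi.single 0 u, Pi.single 0 v, hsum u, hsum v, fun X => ?_⟩
  simpa [vectorFunctional] using
    hasSum_single (f := fun n => ⟪(Pi.single 0 u : ℕ → H) n, X ((Pi.single 0 v : ℕ → H) n)⟫_ℂ)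
      0 fun n hn => by simp [hn]

theorem WeaklyMeasurable.ultraweak (hY : WeaklyMeasurable Y)
    {ω : (H →L[ℂ] H) →ₗ[ℂ] ℂ} (hω : IsUltraweak ω) : Measurable fun a => ω (Y a) := by
  obtain ⟨x, y, -, -, h⟩ := hω
  exact measurable_of_tendsto_metrizable
    (f := fun N a => ∑ n ∈ Finset.range N, ⟪x n, Y a (y n)⟫_ℂ)
    (fun N => Finset.measurable_sum _ fun n _ => hY (x n) (y n))
    (tendsto_pi_nhds.2 fun a => (h (Y a)).tendsto_sum_nat)

theorem WeaklyMeasurable.inner_self [TopologicalSpace.SeparableSpace H] [MeasurableSpace H]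
    [BorelSpace H] (hY : WeaklyMeasurable Y) :
    Measurable fun p : H × α => ⟪p.1, Y p.2 p.1⟫_ℂ := by
  have : SecondCountableTopology H := UniformSpace.secondCountable_of_separable H
  exact measurable_uncurry_of_continuous_of_measurable (u := fun (v : H) a => ⟪v, Y a v⟫_ℂ)
    (fun a => by fun_prop) fun v => hY v v

variable {τ : ℝ} {Y Z : ℝ → H →L[ℂ] H}

/-- The operator families on `[τ, ∞)` that are bounded and weakly measurable. Measurability is
imposed on `[τ, ∞)` only, whence the clamped time. -/
structure IsAdmissible (τ : ℝ) (Y : ℝ → H →L[ℂ] H) : Prop where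
  bounded : ∃ K, ∀ t, τ ≤ t → ‖Y t‖ ≤ K
  measurable : WeaklyMeasurable fun t => Y (max τ t)

theorem isAdmissible_one (τ : ℝ) : IsAdmissible τ (1 : ℝ → H →L[ℂ] H) :=
  ⟨⟨‖(1 : H →L[ℂ] H)‖, fun _ _ => le_rfl⟩, fun x y => measurable_const (a := ⟪x, y⟫_ℂ)⟩

theorem IsAdmissible.congr (hY : IsAdmissible τ Y) (h : EqOn Y Z (Ici τ)) :
    IsAdmissible τ Z := by
  obtain ⟨⟨K, hK⟩, hYm⟩ := hY
  refine ⟨⟨K, fun t ht => h ht ▸ hK t ht⟩, fun x y => ?_⟩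
  simpa only [fun t => h (le_max_left τ t)] using hYm x y

theorem IsAdmissible.add (hY : IsAdmissible τ Y) (hZ : IsAdmissible τ Z) :
    IsAdmissible τ (Y + Z) := by
  obtain ⟨⟨K, hK⟩, hYm⟩ := hY
  obtain ⟨⟨K', hK'⟩, hZm⟩ := hZ
  refine ⟨⟨K + K', fun t ht => norm_add_le_of_le (hK t ht) (hK' t ht)⟩, fun x y => ?_⟩
  simp only [Pi.add_apply, add_apply, inner_add_right]
  exact (hYm x y).add (hZm x y)

theorem IsAdmissible.smul (hY : IsAdmissible τ Y) (a : ℂ) : IsAdmissible τ (a • Y) := by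
  obtain ⟨⟨K, hK⟩, hYm⟩ := hY
  refine ⟨⟨‖a‖ * K, fun t ht => (norm_smul_le a (Y t)).trans ?_⟩, fun x y => ?_⟩
  · exact mul_le_mul_of_nonneg_left (hK t ht) (norm_nonneg a)
  · simp only [Pi.smul_apply, smul_apply, inner_smul_right]
    exact (hYm x y).const_mul a

theorem IsAdmissible.sub (hY : IsAdmissible τ Y) (hZ : IsAdmissible τ Z) :
    IsAdmissible τ (Y - Z) := by
  simpa [sub_eq_add_neg] using hY.add (hZ.smul (-1))

end WeakMeasurability

end MME

namespace MarkovMasterEquation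

open MME

open scoped ComplexOrder

variable {H : Type*} [NormedAddCommGroup H] [InnerProductSpace ℂ H] [CompleteSpace H]
  {M : MarkovMasterEquation H} {τ t : ℝ} {Y Z : ℝ → H →L[ℂ] H} {ψ : H} {B : H →L[ℂ] H} {K : ℝ}

/-! ### The jump operator -/

/-- The conditions on the data under which the minimal solution is constructed: a dense subspace
`D` invariant under the evolution system takes the place of the joint core. -/
structure WeakDomainContinuity (M : MarkovMasterEquation H) : Prop where
  evolution : M.IsEvolutionSystem
  dense_D : Dense (M.D : Set H)
  D_le_G : ∀ t, 0 ≤ t → M.D ≤ (M.G t).domain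
  Λ_ge : IsSelfAdjointGeOne M.Λ
  D_le : M.D ≤ (sqrtOp M.Λ).domain
  G_add_adjoint : ∀ t, 0 ≤ t → ∀ φ ∈ M.D, ∀ ψ ∈ M.D,
    ⟪ev (M.G t) φ, ψ⟫_ℂ + ⟪φ, ev (M.G t) ψ⟫_ℂ = M.phi t 1 φ ψ
  phi_one_le : ∀ t, 0 ≤ t → ∀ ψ ∈ M.D, (M.phi t 1 ψ ψ).re ≤ ‖M.sq ψ‖ ^ 2
  normal : ∀ t, 0 ≤ t → IsNormalMap (M.A t).toLinearMap
  ultraweak_continuous : ∀ X : H →L[ℂ] H, ∀ ω : (H →L[ℂ] H) →ₗ[ℂ] ℂ, IsUltraweak ω →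
    ContinuousOn (fun t => ω (M.A t X)) (Ici 0)
  sq_memLp : ∀ ψ ∈ M.D, ∀ t, 0 ≤ t →
    MemLp (fun s => M.sq (M.W s t ψ)) 2 (volume.restrict (Icc 0 t))

theorem DomainContinuity.weaken (hM : M.DomainContinuity) : M.WeakDomainContinuity where
  __ := hM
  dense_D := dense_of_hasCore (hM.core 0 le_rfl) (hM.G_dense 0 le_rfl)
  D_le_G t ht := (hM.core t ht).le_domain
  phi_one_le t ht ψ hψ := hM.phi_one_le t ht ψ (hM.D_le hψ)

/-- The integrand `s ↦ Φₛ(Yₛ)[W s t ψ]` of the iteration. -/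
def phiAlong (M : MarkovMasterEquation H) (t : ℝ) (Y : ℝ → H →L[ℂ] H) (ψ : H) (s : ℝ) : ℂ :=
  M.phi s (Y s) (M.W s t ψ) (M.W s t ψ)

/-- The jump operator `J(Y)ₜ`: the bounded operator with form `∫_τ^t Φₛ(Yₛ)[W s t ψ] ds` on `D`.
The iteration is `P⁽ⁿ⁺¹⁾ = P⁽⁰⁾ + J(P⁽ⁿ⁾)`. -/
def jump (M : MarkovMasterEquation H) (τ : ℝ) (Y : ℝ → H →L[ℂ] H) (t : ℝ) : H →L[ℂ] H :=
  opOfForm M.D fun ψ => ∫ s in τ..t, M.phiAlong t Y ψ s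

theorem norm_phi_le (s : ℝ) (X : H →L[ℂ] H) (ψ : H) :
    ‖M.phi s X ψ ψ‖ ≤ 2 * ‖X‖ * (M.phi s 1 ψ ψ).re :=
  norm_inner_apply_le (PositiveLinearMap.ofClass (M.A s)) X (M.sq ψ)

theorem phi_mono (s : ℝ) {X X' : H →L[ℂ] H} (h : X ≤ X') (ψ : H) :
    M.phi s X ψ ψ ≤ M.phi s X' ψ ψ :=
  inner_mono (OrderHomClass.mono (M.A s) h) (M.sq ψ)

theorem phi_one_re_nonneg (s : ℝ) (ψ : H) : 0 ≤ (M.phi s 1 ψ ψ).re :=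
  re_inner_nonneg (map_nonneg (M.A s) zero_le_one) (M.sq ψ)

theorem inner_P_zero (M : MarkovMasterEquation H) (τ t : ℝ) (B : H →L[ℂ] H) (x y : H) :
    ⟪x, M.P 0 τ t B y⟫_ℂ = ⟪M.W τ t x, B (M.W τ t y)⟫_ℂ := by
  rw [P, ContinuousLinearMap.star_eq_adjoint]
  exact ContinuousLinearMap.adjoint_inner_right _ _ _

theorem P_zero_nonneg (τ t : ℝ) (hB : 0 ≤ B) : 0 ≤ M.P 0 τ t B :=
  star_left_conjugate_nonneg hB (M.W τ t)

namespace WeakDomainContinuity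

variable (hM : M.WeakDomainContinuity)
include hM

theorem weaklyMeasurable_A (hτ : 0 ≤ τ) (hY : WeaklyMeasurable Y) :
    WeaklyMeasurable fun s => M.A (max τ s) (Y s) := by
  intro x y
  have hu := isUltraweak_vectorFunctional x y
  have hjoint : Measurable (Function.uncurry fun s r =>
      vectorFunctional x y (M.A (max τ s) (Y r))) :=
    measurable_uncurry_of_continuous_of_measurable
      (fun r => (hM.ultraweak_continuous (Y r) _ hu).comp_continuous (by fun_prop)
        fun s => hτ.trans (le_max_left τ s))
      fun s => hY.ultraweak (hM.normal _ (hτ.trans (le_max_left τ s)) _ hu)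
  exact hjoint.comp (measurable_id.prodMk measurable_id)

theorem continuous_W_clamp (hτ : 0 ≤ τ) (ψ : H) :
    Continuous fun p : ℝ × ℝ => M.W (max τ p.1) (max (max τ p.1) p.2) ψ :=
  (hM.evolution.continuousOn ψ).comp_continuous
    (f := fun p : ℝ × ℝ => (max τ p.1, max (max τ p.1) p.2)) (by fun_prop)
    fun p => ⟨hτ.trans (le_max_left _ _), le_max_left _ _⟩

theorem continuous_W_right (hτ : 0 ≤ τ) (ψ : H) : Continuous fun t => M.W τ (max τ t) ψ := by
  simpa [Function.comp_def] using (hM.continuous_W_clamp hτ ψ).comp (Continuous.prodMk_right τ)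

theorem continuousOn_W_left (ψ : H) : ContinuousOn (fun s => M.W s t ψ) (Icc 0 t) :=
  (hM.evolution.continuousOn ψ).comp (f := fun s => (s, t)) (by fun_prop) fun s hs => hs

theorem isAdmissible_P_zero (hτ : 0 ≤ τ) (B : H →L[ℂ] H) :
    IsAdmissible τ fun t => M.P 0 τ t B := by
  refine ⟨⟨‖B‖, fun t hτt => ?_⟩, fun x y => ?_⟩
  · have hW := hM.evolution.norm_le τ t hτ hτt
    calc ‖star (M.W τ t) * B * M.W τ t‖ ≤ ‖star (M.W τ t)‖ * ‖B‖ * ‖M.W τ t‖ := norm_mul₃_le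
      _ ≤ 1 * ‖B‖ * 1 := by rw [norm_star]; gcongr
      _ = ‖B‖ := by ring
  · simp only [inner_P_zero]
    exact ((hM.continuous_W_right hτ x).inner
      (B.continuous.comp (hM.continuous_W_right hτ y))).measurable

theorem hasDerivWithinAt_W {s : ℝ} (hs : 0 ≤ s) (hst : s < t) (hψ : ψ ∈ M.D) :
    HasDerivWithinAt (fun r => M.W r t ψ) (ev (M.G s) (M.W s t ψ)) (Ioi s) s := by
  refine (hM.evolution.deriv_left s t hs hst.le ψ hψ).mono_of_mem_nhdsWithin ?_
  filter_upwards [Ioc_mem_nhdsGT hst] with r hr using ⟨hs.trans hr.1.le, hr.2⟩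

variable [TopologicalSpace.SeparableSpace H]

/-- `Λ^{1/2}` inverts the continuous injection `Λ^{-1/2}`, whose range is Borel. -/
theorem measurable_sq [MeasurableSpace H] [BorelSpace H] :
    Measurable M.sq := by
  have : SecondCountableTopology H := UniformSpace.secondCountable_of_separable H
  have hinj := hM.Λ_ge.invSqrt_injective
  have hext : M.sq = Function.extend (invSqrt M.Λ) id fun _ => 0 := by
    funext x
    by_cases hx : x ∈ range (invSqrt M.Λ)
    · obtain ⟨y, rfl⟩ := hx
      rw [hinj.extend_apply, sq, hM.Λ_ge.ev_sqrtOp_invSqrt, id]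
    · rw [Function.extend_apply' _ _ _ hx, sq, ev, dif_neg]
      exact fun h => hx (mem_domain_sqrtOp.1 h)
  rw [hext]
  exact ((invSqrt M.Λ).continuous.measurableEmbedding hinj).measurable_extend measurable_id
    measurable_const

theorem measurable_phiAlong (hτ : 0 ≤ τ)
    (hY : IsAdmissible τ Y) (ψ : H) :
    Measurable fun p : ℝ × ℝ => M.phiAlong (max (max τ p.1) p.2) Y ψ (max τ p.1) := by
  borelize H
  exact (hM.weaklyMeasurable_A hτ hY.measurable).inner_self.comp
    ((hM.measurable_sq.comp (hM.continuous_W_clamp hτ ψ).measurable).prodMk measurable_fst)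

theorem intervalIntegrable_phiAlong (hτ : 0 ≤ τ)
    (hτt : τ ≤ t) (hY : IsAdmissible τ Y) (hψ : ψ ∈ M.D) :
    IntervalIntegrable (M.phiAlong t Y ψ) volume τ t := by
  rw [intervalIntegrable_iff_integrableOn_Ioc_of_le hτt]
  obtain ⟨K, hK⟩ := hY.bounded
  have hsub : Ioc τ t ⊆ Icc 0 t := fun s hs => ⟨hτ.trans hs.1.le, hs.2⟩
  have hsq : IntegrableOn (fun s => ‖M.sq (M.W s t ψ)‖ ^ 2) (Ioc τ t) :=
    IntegrableOn.mono_set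
      ((hM.sq_memLp ψ hψ t (hτ.trans hτt)).integrable_norm_pow two_ne_zero) hsub
  refine Integrable.mono' (Integrable.const_mul hsq (2 * K)) ?_ ?_
  · refine ((hM.measurable_phiAlong hτ hY ψ).comp
      (measurable_id.prodMk measurable_const)).aestronglyMeasurable.congr
      (f := fun s => M.phiAlong (max (max τ s) t) Y ψ (max τ s)) ?_
    filter_upwards [ae_restrict_mem measurableSet_Ioc] with s hs
    rw [max_eq_right hs.1.le, max_eq_right hs.2]
  · filter_upwards [ae_restrict_mem measurableSet_Ioc] with s hs
    have hs0 := hsub hs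
    calc ‖M.phiAlong t Y ψ s‖ ≤ 2 * ‖Y s‖ * (M.phi s 1 (M.W s t ψ) (M.W s t ψ)).re :=
          norm_phi_le s (Y s) (M.W s t ψ)
      _ ≤ 2 * K * ‖M.sq (M.W s t ψ)‖ ^ 2 := by
          have hYs := hK s hs.1.le
          have hΦ := hM.phi_one_le s hs0.1 _ (hM.evolution.maps_core s t hs0.1 hs0.2 ψ hψ)
          have := phi_one_re_nonneg (M := M) s (M.W s t ψ)
          have := (norm_nonneg _).trans hYs
          gcongr

/-- The energy balance, from `Gₜ* + Gₜ = Φₜ(I)`. -/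
theorem integral_phiAlong_one (hτ : 0 ≤ τ) (hτt : τ ≤ t)
    (hψ : ψ ∈ M.D) : ∫ s in τ..t, M.phiAlong t 1 ψ s =
      ⟪ψ, ψ⟫_ℂ - ⟪M.W τ t ψ, M.W τ t ψ⟫_ℂ := by
  have hc : ContinuousOn (fun s => M.W s t ψ) (Icc τ t) :=
    (hM.continuousOn_W_left ψ).mono (Icc_subset_Icc hτ le_rfl)
  rw [intervalIntegral.integral_eq_sub_of_hasDeriv_right_of_le
    (f := fun s => ⟪M.W s t ψ, M.W s t ψ⟫_ℂ) hτt (hc.inner (𝕜 := ℂ) hc) (fun s hs => ?_)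
    (hM.intervalIntegrable_phiAlong hτ hτt (isAdmissible_one τ) hψ)]
  · rw [hM.evolution.refl t (hτ.trans hτt), one_apply_eq_self]
  · have hs0 := hτ.trans hs.1.le
    have hd := hM.hasDerivWithinAt_W hs0 hs.2 hψ
    have hW := hM.evolution.maps_core s t hs0 hs.2.le ψ hψ
    simpa only [add_comm, phiAlong, Pi.one_apply, ← hM.G_add_adjoint s hs0 _ hW _ hW] using
      hd.inner ℂ hd

theorem norm_integral_phiAlong_le (hτ : 0 ≤ τ) (hτt : τ ≤ t)
    (hK : ∀ s, τ ≤ s → ‖Y s‖ ≤ K) (hψ : ψ ∈ M.D) :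
    ‖∫ s in τ..t, M.phiAlong t Y ψ s‖ ≤ 2 * K * ‖ψ‖ ^ 2 := by
  have hK0 : 0 ≤ K := (norm_nonneg _).trans (hK τ le_rfl)
  have hint := hM.intervalIntegrable_phiAlong hτ hτt (isAdmissible_one τ) hψ
  have hre : ∫ s in τ..t, (M.phiAlong t 1 ψ s).re = (∫ s in τ..t, M.phiAlong t 1 ψ s).re :=
    Complex.reCLM.intervalIntegral_comp_comm hint
  calc ‖∫ s in τ..t, M.phiAlong t Y ψ s‖
      ≤ ∫ s in τ..t, 2 * K * (M.phiAlong t 1 ψ s).re := by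
        refine intervalIntegral.norm_integral_le_of_norm_le hτt
          (Eventually.of_forall fun s hs => ?_) (IntervalIntegrable.const_mul
            ⟨hint.1.re, hint.2.re⟩ _)
        exact (norm_phi_le s (Y s) _).trans (mul_le_mul_of_nonneg_right
          (mul_le_mul_of_nonneg_left (hK s hs.1.le) zero_le_two) (phi_one_re_nonneg s _))
    _ = 2 * K * (‖ψ‖ ^ 2 - ‖M.W τ t ψ‖ ^ 2) := by
        rw [intervalIntegral.integral_const_mul, hre, hM.integral_phiAlong_one hτ hτt hψ,
          inner_self_eq_norm_sq_to_K, inner_self_eq_norm_sq_to_K]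
        norm_cast
    _ ≤ 2 * K * ‖ψ‖ ^ 2 := by
        gcongr
        exact sub_le_self _ (sq_nonneg _)

theorem exists_operator_integral_phiAlong (hτ : 0 ≤ τ)
    (hτt : τ ≤ t) (hY : IsAdmissible τ Y) :
    ∃ T : H →L[ℂ] H, ∀ ψ ∈ M.D, ⟪ψ, T ψ⟫_ℂ = ∫ s in τ..t, M.phiAlong t Y ψ s := by
  obtain ⟨K, hK⟩ := hY.bounded
  have hlin : ∀ s ∈ Ioc τ t, ∃ ℓ : M.D →ₗ[ℂ] H, ∀ ψ : M.D, ℓ ψ = M.sq (M.W s t ψ) := by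
    intro s hs
    have hmem (ψ : M.D) : M.W s t ψ ∈ (sqrtOp M.Λ).domain :=
      hM.D_le (hM.evolution.maps_core s t (hτ.trans hs.1.le) hs.2 ψ ψ.2)
    refine ⟨(sqrtOp M.Λ).toFun ∘ₗ ((M.W s t).toLinearMap ∘ₗ M.D.subtype).codRestrict _ hmem,
      fun ψ => ?_⟩
    rw [sq, ev_of_mem (hmem ψ)]
    rfl
  choose! ℓ hℓ using hlin
  have hform : ∀ ψ : M.D, EqOn (M.phiAlong t Y ψ)
      (fun s => operatorForm (ℓ s) (M.A s (Y s)) ψ ψ) (Ioc τ t) := fun ψ s hs => by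
    simp only [operatorForm_apply, hℓ s hs ψ, phiAlong, phi]
  obtain ⟨R, hR⟩ := exists_integral_sesq (μ := volume.restrict (Ioc τ t))
    (Q := fun s => operatorForm (ℓ s) (M.A s (Y s))) fun ψ =>
      (hM.intervalIntegrable_phiAlong hτ hτt hY ψ.2).1.congr_fun (hform ψ) measurableSet_Ioc
  have hRint : ∀ ψ : M.D, R ψ ψ = ∫ s in τ..t, M.phiAlong t Y ψ s := fun ψ => by
    rw [hR, intervalIntegral.integral_of_le hτt, setIntegral_congr_fun measurableSet_Ioc (hform ψ)]
  have hK0 : 0 ≤ K := (norm_nonneg _).trans (hK τ le_rfl)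
  obtain ⟨T, hT⟩ := exists_operator_of_sesq (e := M.D.subtypeₗᵢ) (Q := R) (C := 2 * K)
    (by simpa [DenseRange] using hM.dense_D) (by positivity) fun ψ =>
      hRint ψ ▸ hM.norm_integral_phiAlong_le hτ hτt hK ψ.2
  exact ⟨T, fun ψ hψ => (hT ⟨ψ, hψ⟩ ⟨ψ, hψ⟩).trans (hRint _)⟩

theorem inner_jump (hτ : 0 ≤ τ) (hτt : τ ≤ t)
    (hY : IsAdmissible τ Y) (hψ : ψ ∈ M.D) :
    ⟪ψ, M.jump τ Y t ψ⟫_ℂ = ∫ s in τ..t, M.phiAlong t Y ψ s :=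
  inner_opOfForm (hM.exists_operator_integral_phiAlong hτ hτt hY) hψ

theorem measurable_integral_phiAlong (hτ : 0 ≤ τ)
    (hY : IsAdmissible τ Y) (ψ : H) :
    Measurable fun t => ∫ s in τ..max τ t, M.phiAlong (max τ t) Y ψ s := by
  let E : Set (ℝ × ℝ) := {p | p.2 ∈ Ioc τ (max τ p.1)}
  have hE : MeasurableSet E :=
    (measurableSet_lt measurable_const measurable_snd).inter
      (measurableSet_le measurable_snd (measurable_const.max measurable_fst))
  have hind : Measurable (E.indicator fun p =>
      M.phiAlong (max (max τ p.2) (max τ p.1)) Y ψ (max τ p.2)) :=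
    ((hM.measurable_phiAlong hτ hY ψ).comp
      (measurable_snd.prodMk (measurable_const.max measurable_fst))).indicator hE
  convert (hind.stronglyMeasurable.integral_prod_right' (ν := volume)).measurable using 2 with t
  rw [intervalIntegral.integral_of_le (le_max_left _ _), ← integral_indicator measurableSet_Ioc]
  congr 1
  funext s
  by_cases hs : s ∈ Ioc τ (max τ t)
  · rw [indicator_of_mem hs, indicator_of_mem (show (t, s) ∈ E from hs), max_eq_right hs.1.le,
      max_eq_right hs.2]
  · rw [indicator_of_notMem hs, indicator_of_notMem (show (t, s) ∉ E from hs)]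

theorem isAdmissible_jump (hτ : 0 ≤ τ)
    (hY : IsAdmissible τ Y) : IsAdmissible τ (M.jump τ Y) := by
  obtain ⟨K, hK⟩ := hY.bounded
  have hK0 : 0 ≤ K := (norm_nonneg _).trans (hK τ le_rfl)
  refine ⟨⟨2 * (2 * K), fun t hτt => ?_⟩, weaklyMeasurable_of_dense hM.dense_D fun ψ hψ => ?_⟩
  · refine opNorm_le_of_forall_norm_inner_le hM.dense_D (by positivity) fun ψ hψ => ?_
    rw [hM.inner_jump hτ hτt hY hψ]
    exact hM.norm_integral_phiAlong_le hτ hτt hK hψ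
  · simp only [hM.inner_jump hτ (le_max_left _ _) hY hψ]
    exact hM.measurable_integral_phiAlong hτ hY ψ

theorem eq_jump (hτ : 0 ≤ τ) (hτt : τ ≤ t)
    (hY : IsAdmissible τ Y)
    (h : ∀ ψ ∈ M.D, ⟪ψ, B ψ⟫_ℂ = ∫ s in τ..t, M.phiAlong t Y ψ s) : B = M.jump τ Y t :=
  eq_of_forall_inner_eq hM.dense_D fun ψ hψ => by rw [h ψ hψ, hM.inner_jump hτ hτt hY hψ]

theorem jump_add (hτ : 0 ≤ τ) (hτt : τ ≤ t)
    (hY : IsAdmissible τ Y) (hZ : IsAdmissible τ Z) :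
    M.jump τ (Y + Z) t = M.jump τ Y t + M.jump τ Z t := by
  refine (hM.eq_jump hτ hτt (hY.add hZ) fun ψ hψ => ?_).symm
  rw [add_apply, inner_add_right, hM.inner_jump hτ hτt hY hψ, hM.inner_jump hτ hτt hZ hψ,
    ← intervalIntegral.integral_add (hM.intervalIntegrable_phiAlong hτ hτt hY hψ)
      (hM.intervalIntegrable_phiAlong hτ hτt hZ hψ)]
  simp only [phiAlong, phi, Pi.add_apply, map_add, add_apply, inner_add_right]

theorem jump_smul (hτ : 0 ≤ τ) (hτt : τ ≤ t)
    (hY : IsAdmissible τ Y) (a : ℂ) : M.jump τ (a • Y) t = a • M.jump τ Y t := by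
  refine (hM.eq_jump hτ hτt (hY.smul a) fun ψ hψ => ?_).symm
  rw [smul_apply, inner_smul_right, hM.inner_jump hτ hτt hY hψ,
    ← intervalIntegral.integral_const_mul]
  simp only [phiAlong, phi, Pi.smul_apply, map_smul, smul_apply, inner_smul_right]

theorem jump_sub (hτ : 0 ≤ τ) (hτt : τ ≤ t)
    (hY : IsAdmissible τ Y) (hZ : IsAdmissible τ Z) :
    M.jump τ (Y - Z) t = M.jump τ Y t - M.jump τ Z t :=
  eq_sub_of_add_eq (by rw [← hM.jump_add hτ hτt (hY.sub hZ) hZ, sub_add_cancel])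

theorem jump_mono (hτ : 0 ≤ τ) (hτt : τ ≤ t)
    (hY : IsAdmissible τ Y) (hZ : IsAdmissible τ Z) (h : ∀ s ∈ Icc τ t, Y s ≤ Z s) :
    M.jump τ Y t ≤ M.jump τ Z t := by
  refine le_of_forall_inner_le hM.dense_D fun ψ hψ => ?_
  rw [hM.inner_jump hτ hτt hY hψ, hM.inner_jump hτ hτt hZ hψ,
    intervalIntegral.integral_of_le hτt, intervalIntegral.integral_of_le hτt]
  refine integral_mono_ae (hM.intervalIntegrable_phiAlong hτ hτt hY hψ).1
    (hM.intervalIntegrable_phiAlong hτ hτt hZ hψ).1 ?_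
  filter_upwards [ae_restrict_mem measurableSet_Ioc] with s hs
    using phi_mono s (h s ⟨hs.1.le, hs.2⟩) _

theorem jump_nonneg (hτ : 0 ≤ τ) (hτt : τ ≤ t)
    (hY : IsAdmissible τ Y) (h : ∀ s ∈ Icc τ t, 0 ≤ Y s) : 0 ≤ M.jump τ Y t := by
  have hzero : M.jump τ ((0 : ℂ) • Y) t = 0 := by rw [hM.jump_smul hτ hτt hY, zero_smul]
  rw [← hzero]
  exact hM.jump_mono hτ hτt (hY.smul 0) hY fun s hs => by simpa using h s hs

/-! ### The minimal solution -/

theorem P_succ_of_isAdmissible {n : ℕ} (hτ : 0 ≤ τ) (hτt : τ ≤ t)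
    (h : IsAdmissible τ fun s => M.P n τ s B) :
    M.P (n + 1) τ t B = M.P 0 τ t B + M.jump τ (fun s => M.P n τ s B) t := by
  have hsum : ∀ ψ ∈ M.D, ⟪ψ, (M.P 0 τ t B + M.jump τ (fun s => M.P n τ s B) t) ψ⟫_ℂ =
      ⟪M.W τ t ψ, B (M.W τ t ψ)⟫_ℂ + ∫ s in τ..t, M.phiAlong t (fun s => M.P n τ s B) ψ s :=
    fun ψ hψ => by rw [add_apply, inner_add_right, inner_P_zero, hM.inner_jump hτ hτt h hψ]
  exact eq_of_forall_inner_eq hM.dense_D fun ψ hψ =>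
    (inner_opOfForm ⟨_, hsum⟩ hψ).trans (hsum ψ hψ).symm

theorem isAdmissible_P (hτ : 0 ≤ τ) (n : ℕ) (B : H →L[ℂ] H) :
    IsAdmissible τ fun t => M.P n τ t B := by
  induction n with
  | zero => exact hM.isAdmissible_P_zero hτ B
  | succ n ih =>
    exact ((hM.isAdmissible_P_zero hτ B).add (hM.isAdmissible_jump hτ ih)).congr
      fun t hτt => (hM.P_succ_of_isAdmissible hτ hτt ih).symm

theorem P_succ (hτ : 0 ≤ τ) (hτt : τ ≤ t) (n : ℕ) (B : H →L[ℂ] H) :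
    M.P (n + 1) τ t B = M.P 0 τ t B + M.jump τ (fun s => M.P n τ s B) t :=
  hM.P_succ_of_isAdmissible hτ hτt (hM.isAdmissible_P hτ n B)

theorem inner_P_succ (hτ : 0 ≤ τ) (hτt : τ ≤ t) (n : ℕ) (B : H →L[ℂ] H) (hψ : ψ ∈ M.D) :
    ⟪ψ, M.P (n + 1) τ t B ψ⟫_ℂ = ⟪M.W τ t ψ, B (M.W τ t ψ)⟫_ℂ +
      ∫ s in τ..t, M.phiAlong t (fun s => M.P n τ s B) ψ s := by
  rw [hM.P_succ hτ hτt, add_apply, inner_add_right, inner_P_zero,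
    hM.inner_jump hτ hτt (hM.isAdmissible_P hτ n B) hψ]

theorem iteratesWellDefined : M.IteratesWellDefined := fun n _ _ hτ hτt B _ hψ =>
  ⟨hM.intervalIntegrable_phiAlong hτ hτt (hM.isAdmissible_P hτ n B) hψ,
    hM.inner_P_succ hτ hτt n B hψ⟩

theorem P_nonneg (hτ : 0 ≤ τ) (hτt : τ ≤ t) (n : ℕ) (hB : 0 ≤ B) : 0 ≤ M.P n τ t B := by
  induction n generalizing t with
  | zero => exact P_zero_nonneg τ t hB
  | succ n ih =>
    rw [hM.P_succ hτ hτt]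
    exact add_nonneg (P_zero_nonneg τ t hB)
      (hM.jump_nonneg hτ hτt (hM.isAdmissible_P hτ n B) fun s hs => ih hs.1)

theorem P_le_P_succ (hτ : 0 ≤ τ) (hτt : τ ≤ t) (hB : 0 ≤ B) (n : ℕ) :
    M.P n τ t B ≤ M.P (n + 1) τ t B := by
  induction n generalizing t with
  | zero =>
    rw [hM.P_succ hτ hτt]
    exact le_add_of_nonneg_right
      (hM.jump_nonneg hτ hτt (hM.isAdmissible_P hτ 0 B) fun s hs => hM.P_nonneg hτ hs.1 0 hB)
  | succ n ih =>
    rw [hM.P_succ hτ hτt, hM.P_succ hτ hτt (n + 1)]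
    exact add_le_add_right (hM.jump_mono hτ hτt (hM.isAdmissible_P hτ n B)
      (hM.isAdmissible_P hτ (n + 1) B) fun s hs => ih hs.1) _

theorem P_le_of_supersolution (hτ : 0 ≤ τ) (hY : IsAdmissible τ Y)
    (hY0 : ∀ s, τ ≤ s → 0 ≤ Y s) (h : ∀ s, τ ≤ s → M.P 0 τ s B + M.jump τ Y s ≤ Y s)
    (hτt : τ ≤ t) (n : ℕ) : M.P n τ t B ≤ Y t := by
  induction n generalizing t with
  | zero =>
    exact le_of_add_le_of_nonneg_left (h t hτt)
      (hM.jump_nonneg hτ hτt hY fun s hs => hY0 s hs.1)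
  | succ n ih =>
    rw [hM.P_succ hτ hτt]
    exact (add_le_add_right (hM.jump_mono hτ hτt (hM.isAdmissible_P hτ n B) hY
      fun s hs => ih hs.1) _).trans (h t hτt)

theorem P_zero_one_add_jump_one (hτ : 0 ≤ τ) (hτt : τ ≤ t) :
    M.P 0 τ t 1 + M.jump τ 1 t = 1 :=
  eq_of_forall_inner_eq hM.dense_D fun ψ hψ => by
    rw [add_apply, inner_add_right, inner_P_zero, hM.inner_jump hτ hτt (isAdmissible_one τ) hψ,
      hM.integral_phiAlong_one hτ hτt hψ]
    exact add_sub_cancel _ _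

theorem P_le_smul_one (hτ : 0 ≤ τ) (hτt : τ ≤ t) {b : ℂ} (hb : 0 ≤ b • (1 : H →L[ℂ] H))
    (hB : B ≤ b • 1) (n : ℕ) : M.P n τ t B ≤ b • 1 := by
  refine hM.P_le_of_supersolution (Y := b • 1) hτ ((isAdmissible_one τ).smul b) (fun _ _ => hb)
    (fun s hs => ?_) hτt n
  calc M.P 0 τ s B + M.jump τ (b • 1) s ≤ M.P 0 τ s (b • 1) + M.jump τ (b • 1) s :=
        add_le_add_left (star_left_conjugate_le_conjugate hB _) _
    _ = b • (M.P 0 τ s 1 + M.jump τ 1 s) := by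
        rw [hM.jump_smul hτ hs (isAdmissible_one τ), smul_add]
        simp only [P, mul_smul_comm, smul_mul_assoc]
    _ = b • 1 := by rw [hM.P_zero_one_add_jump_one hτ hs]

theorem exists_isLUB_tendsto_P (hτ : 0 ≤ τ) (hτt : τ ≤ t) (hB : 0 ≤ B) :
    ∃ T, IsLUB (range fun n => M.P n τ t B) T ∧
      ∀ ψ, Tendsto (fun n => ⟪ψ, M.P n τ t B ψ⟫_ℂ) atTop (𝓝 ⟪ψ, T ψ⟫_ℂ) := by
  have hle : B ≤ ((‖B‖ : ℝ) : ℂ) • (1 : H →L[ℂ] H) := by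
    simpa [Algebra.algebraMap_eq_smul_one] using
      (IsSelfAdjoint.of_nonneg hB).le_algebraMap_norm_self
  refine exists_isLUB_tendsto_of_monotone (monotone_nat_of_le_succ (hM.P_le_P_succ hτ hτt hB))
    (fun n => hM.P_nonneg hτ hτt n hB) (norm_nonneg B) fun n ψ => ?_
  refine (re_inner_mono (hM.P_le_smul_one hτ hτt (hB.trans hle) hle n) ψ).trans_eq ?_
  rw [smul_apply, inner_smul_right, one_apply_eq_self, Complex.re_ofReal_mul,
    ← RCLike.re_to_complex, inner_self_eq_norm_sq]

theorem isLUB_Pmin_and_tendsto_P (hτ : 0 ≤ τ) (hτt : τ ≤ t) (hB : 0 ≤ B) :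
    IsLUB (range fun n => M.P n τ t B) (M.Pmin τ t B) ∧
      ∀ ψ, Tendsto (fun n => ⟪ψ, M.P n τ t B ψ⟫_ℂ) atTop (𝓝 ⟪ψ, M.Pmin τ t B ψ⟫_ℂ) := by
  obtain ⟨T, hT, hlim⟩ := hM.exists_isLUB_tendsto_P hτ hτt hB
  have hex : ∃ T, IsLUB (range fun n => M.P n τ t B) T := ⟨T, hT⟩
  have hPmin : M.Pmin τ t B = T := by
    rw [Pmin, dif_pos hex]
    exact hex.choose_spec.unique hT
  exact hPmin ▸ ⟨hT, hlim⟩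

end WeakDomainContinuity

/-! ### Reference families -/

variable {L : ℝ → H →ₗ.[ℂ] H} {c a : ℝ → ℝ}

/-- A reference family with rate `c`, in a form that refers to `Λ` only through the maps `Φₜ`. -/
structure IsWeakReferenceFamily (M : MarkovMasterEquation H) (L : ℝ → H →ₗ.[ℂ] H) (c : ℝ → ℝ) :
    Prop where
  ge_one : ∀ t, 0 ≤ t → IsSelfAdjointGeOne (L t)
  D_le : ∀ t, 0 ≤ t → M.D ≤ (L t).domain
  core : ∀ t, 0 ≤ t → (sqrtOp (L t)).HasCore M.D
  phi_one_le : ∀ t, 0 ≤ t → ∀ ψ ∈ M.D, (M.phi t 1 ψ ψ).re ≤ ‖ev (sqrtOp (L t)) ψ‖ ^ 2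
  differentiable : ∀ ψ ∈ M.D, DifferentiableOn ℝ (fun t => ev (L t) ψ) (Ici 0)
  continuous_along : ∀ ψ ∈ M.D, ∀ t, 0 ≤ t →
    ContinuousOn (fun s => ‖ev (sqrtOp (L s)) (M.W s t ψ)‖ ^ 2) (Icc 0 t)
  rate_nonneg : ∀ t, 0 ≤ t → 0 ≤ c t
  rate_integrable : LocallyIntegrableOn c (Ici 0)
  inequality : ∀ t, 0 ≤ t → ∀ ψ ∈ M.D, M.phiExt t (L t) ψ ≠ ∞ ∧
    (M.phiExt t (L t) ψ).toReal - 2 * (⟪ev (M.G t) ψ, ev (L t) ψ⟫_ℂ).re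
      - (⟪ψ, derivWithin (fun r => ev (L r) ψ) (Ici 0) t⟫_ℂ).re
      ≤ c t * ‖ev (sqrtOp (L t)) ψ‖ ^ 2

theorem IsReferenceFamily.weaken (hL : M.IsReferenceFamily L c) : M.IsWeakReferenceFamily L c where
  __ := hL

/-- The formal derivative of `s ↦ ‖L s ^ {1/2} W s t ψ‖²`, in terms of `u = W s t ψ`. -/
def formDeriv (M : MarkovMasterEquation H) (L : ℝ → H →ₗ.[ℂ] H) (s : ℝ) (u : H) : ℝ :=
  2 * (⟪ev (M.G s) u, ev (L s) u⟫_ℂ).re +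
    (⟪u, derivWithin (fun r => ev (L r) u) (Ici 0) s⟫_ℂ).re

namespace IsWeakReferenceFamily

variable (hL : M.IsWeakReferenceFamily L c)
include hL

theorem intervalIntegrable_rate (hτ : 0 ≤ τ) (hτt : τ ≤ t) : IntervalIntegrable c volume τ t := by
  rw [intervalIntegrable_iff_integrableOn_Icc_of_le hτt]
  exact hL.rate_integrable.integrableOn_compact_subset (fun s hs => hτ.trans hs.1) isCompact_Icc

theorem re_inner_ev (ht : 0 ≤ t) (hψ : ψ ∈ (L t).domain) :
    (⟪ψ, ev (L t) ψ⟫_ℂ).re = ‖ev (sqrtOp (L t)) ψ‖ ^ 2 := by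
  rw [(hL.ge_one t ht).inner_ev hψ, Complex.ofReal_re]

theorem leOp_iff (ht : 0 ≤ t) :
    LeOp B (L t) ↔ ∀ φ ∈ M.D, (⟪φ, B φ⟫_ℂ).re ≤ ‖ev (sqrtOp (L t)) φ‖ ^ 2 := by
  refine ⟨fun h φ hφ => ?_, fun h x => ?_⟩
  · have hd := hL.D_le t ht hφ
    simpa only [← ev_of_mem hd, hL.re_inner_ev ht hd] using h ⟨φ, hd⟩
  · rw [← ev_of_mem x.2, hL.re_inner_ev ht x.2]
    simpa using re_inner_le_of_hasCore (hL.core t ht) (a := 1) (by simpa using h)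
      ((hL.ge_one t ht).domain_le_domain_sqrtOp x.2)

theorem phi_re_le_phiExt (ht : 0 ≤ t) (hB : 0 ≤ B) (hBL : LeOp B (L t)) (hψ : ψ ∈ M.D) :
    (M.phi t B ψ ψ).re ≤ (M.phiExt t (L t) ψ).toReal :=
  (ENNReal.ofReal_le_iff_le_toReal (hL.inequality t ht ψ hψ).1).1
    (le_iSup_of_le B (le_iSup_of_le hB (le_iSup_of_le hBL le_rfl)))

theorem inv_mul_phi_re_le (ht : 0 ≤ t) (hB : 0 ≤ B) (hK : 0 < K)
    (hBL : ∀ φ ∈ M.D, (⟪φ, B φ⟫_ℂ).re ≤ K * ‖ev (sqrtOp (L t)) φ‖ ^ 2) (hψ : ψ ∈ M.D) :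
    K⁻¹ * (M.phi t B ψ ψ).re ≤ c t * ‖ev (sqrtOp (L t)) ψ‖ ^ 2 + M.formDeriv L t ψ := by
  have hle : LeOp (((K⁻¹ : ℝ) : ℂ) • B) (L t) := (hL.leOp_iff ht).2 fun φ hφ => by
    rw [smul_apply, inner_smul_right, Complex.re_ofReal_mul, inv_mul_le_iff₀ hK]
    exact hBL φ hφ
  have hphi := hL.phi_re_le_phiExt ht
    (smul_nonneg (Complex.zero_le_real.2 (inv_nonneg.2 hK.le)) hB) hle hψ
  have hsmul : M.phi t (((K⁻¹ : ℝ) : ℂ) • B) ψ ψ = ((K⁻¹ : ℝ) : ℂ) * M.phi t B ψ ψ := by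
    simp only [phi, map_smul, smul_apply, inner_smul_right]
  rw [hsmul, Complex.re_ofReal_mul] at hphi
  have hrate := (hL.inequality t ht ψ hψ).2
  rw [formDeriv]
  linarith

theorem hasDerivWithinAt_linearization (hM : M.WeakDomainContinuity) {s : ℝ} (hs : 0 ≤ s)
    (hst : s < t) (hψ : ψ ∈ M.D) :
    HasDerivWithinAt (fun r => (⟪M.W s t ψ, ev (L r) (M.W s t ψ)⟫_ℂ).re +
      2 * (⟪M.W r t ψ - M.W s t ψ, ev (L r) (M.W s t ψ)⟫_ℂ).re)
      (M.formDeriv L s (M.W s t ψ)) (Ioi s) s := by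
  have hdW := hM.hasDerivWithinAt_W hs hst hψ
  have hdL := ((hL.differentiable _ (hM.evolution.maps_core s t hs hst.le ψ hψ) s
    hs).hasDerivWithinAt).mono fun r (hr : r ∈ Ioi s) => hs.trans (le_of_lt hr)
  have hd₁ := Complex.reCLM.hasFDerivAt.comp_hasDerivWithinAt s
    ((hasDerivWithinAt_const s (Ioi s) (M.W s t ψ)).inner ℂ hdL)
  have hd₂ := Complex.reCLM.hasFDerivAt.comp_hasDerivWithinAt s
    ((hdW.sub_const (M.W s t ψ)).inner ℂ hdL)
  convert! hd₁.add (hd₂.const_mul 2) using 1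
  simp [formDeriv, add_comm]

/-- Since `L r ≥ 0`, the form of `L r` at `W r t ψ` lies above its linearization at `W s t ψ`. -/
theorem eventually_le_sub (hM : M.WeakDomainContinuity) {s y : ℝ} (hs : 0 ≤ s) (hst : s < t)
    (hψ : ψ ∈ M.D) (hy : -M.formDeriv L s (M.W s t ψ) < y) :
    ∀ᶠ r in 𝓝[>] s, -‖ev (sqrtOp (L r)) (M.W r t ψ)‖ ^ 2 - -‖ev (sqrtOp (L s)) (M.W s t ψ)‖ ^ 2 ≤
      (r - s) * y := by
  have hd := (hL.hasDerivWithinAt_linearization hM hs hst hψ).neg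
  filter_upwards [hd.limsup_slope_le' self_notMem_Ioi hy, Ioc_mem_nhdsGT hst] with r hslope hr
  have hr0 : 0 ≤ r := hs.trans hr.1.le
  have hsD := hM.evolution.maps_core s t hs hst.le ψ hψ
  have hrD := hM.evolution.maps_core r t hr0 hr.2 ψ hψ
  have hge := re_inner_add_two_mul_le (hL.ge_one r hr0).isSelfAdjoint
    (fun z hz => by rw [hL.re_inner_ev hr0 hz]; positivity)
    (hL.D_le r hr0 hsD) (hL.D_le r hr0 hrD)
  have hlin := mul_le_mul_of_nonneg_left hslope.le (sub_pos.2 hr.1).le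
  rw [← smul_eq_mul, sub_smul_slope] at hlin
  simp only [Pi.neg_apply, vsub_eq_sub, sub_self, inner_zero_left, Complex.zero_re, mul_zero,
    add_zero, hL.re_inner_ev hs (hL.D_le s hs hsD)] at hlin
  rw [hL.re_inner_ev hr0 (hL.D_le r hr0 hrD)] at hge
  linarith

theorem integral_le_sub_of_le_formDeriv (hM : M.WeakDomainContinuity) {φ : ℝ → ℝ} (hτ : 0 ≤ τ)
    (hτt : τ ≤ t) (hψ : ψ ∈ M.D) (hφ : IntervalIntegrable φ volume τ t)
    (h : ∀ s ∈ Icc τ t, φ s ≤ M.formDeriv L s (M.W s t ψ)) :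
    ∫ s in τ..t, φ s ≤ ‖ev (sqrtOp (L t)) ψ‖ ^ 2 - ‖ev (sqrtOp (L τ)) (M.W τ t ψ)‖ ^ 2 := by
  have hf : ContinuousOn (fun s => ‖ev (sqrtOp (L s)) (M.W s t ψ)‖ ^ 2) (Icc τ t) :=
    (hL.continuous_along ψ hψ t (hτ.trans hτt)).mono (Icc_subset_Icc hτ le_rfl)
  have hdini := sub_le_integral_of_dini_le hτt hf.neg hφ.neg fun s hs y hy =>
    hL.eventually_le_sub hM (hτ.trans hs.1) hs.2 hψ
      ((neg_le_neg (h s (Ico_subset_Icc_self hs))).trans_lt hy)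
  simp only [Pi.neg_apply, intervalIntegral.integral_neg, hM.evolution.refl t (hτ.trans hτt),
    one_apply_eq_self] at hdini
  linarith

variable [TopologicalSpace.SeparableSpace H]

theorem norm_sq_add_re_inner_jump_le (hM : M.WeakDomainContinuity) (hτ : 0 ≤ τ) (hτt : τ ≤ t)
    (ha : IntervalIntegrable a volume τ t) (ha0 : ∀ s ∈ Icc τ t, 0 ≤ a s) (hY : IsAdmissible τ Y)
    (hψ : ψ ∈ M.D)
    (h : ∀ s ∈ Icc τ t, Real.exp (-∫ r in τ..s, a r) * (M.phiAlong t Y ψ s).re ≤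
      a s * ‖ev (sqrtOp (L s)) (M.W s t ψ)‖ ^ 2 + M.formDeriv L s (M.W s t ψ)) :
    ‖ev (sqrtOp (L τ)) (M.W τ t ψ)‖ ^ 2 + (⟪ψ, M.jump τ Y t ψ⟫_ℂ).re ≤
      Real.exp (∫ s in τ..t, a s) * ‖ev (sqrtOp (L t)) ψ‖ ^ 2 := by
  have hY_int := hM.intervalIntegrable_phiAlong hτ hτt hY hψ
  have hq : IntervalIntegrable (fun s => (M.phiAlong t Y ψ s).re) volume τ t :=
    ⟨hY_int.1.re, hY_int.2.re⟩
  have hre : (⟪ψ, M.jump τ Y t ψ⟫_ℂ).re = ∫ s in τ..t, (M.phiAlong t Y ψ s).re := by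
    rw [hM.inner_jump hτ hτt hY hψ]
    exact (Complex.reCLM.intervalIntegral_comp_comm hY_int).symm
  have hf : ContinuousOn (fun s => ‖ev (sqrtOp (L s)) (M.W s t ψ)‖ ^ 2) (uIcc τ t) := by
    rw [uIcc_of_le hτt]
    exact (hL.continuous_along ψ hψ t (hτ.trans hτt)).mono (Icc_subset_Icc hτ le_rfl)
  have hexp : ContinuousOn (fun s => Real.exp (-∫ r in τ..s, a r)) (uIcc τ t) :=
    Real.continuous_exp.comp_continuousOn
      (intervalIntegral.continuousOn_primitive_interval' ha left_mem_uIcc).neg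
  have hφ := (hq.continuousOn_mul hexp).sub (ha.mul_continuousOn hf)
  rw [uIcc_of_le hτt] at hf
  have hgronwall := add_integral_le_exp_mul hτt hf ha hq ha0 fun s hs => by
    have hsub : uIcc s t ⊆ uIcc τ t := uIcc_subset_uIcc_right (uIcc_of_le hτt ▸ hs)
    rw [hM.evolution.refl t (hτ.trans hτt), one_apply_eq_self]
    exact hL.integral_le_sub_of_le_formDeriv hM (hτ.trans hs.1) hs.2 hψ (hφ.mono_set hsub)
      fun r hr => sub_le_iff_le_add'.2 (h r ⟨hs.1.trans hr.1, hr.2⟩)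
  rwa [hM.evolution.refl t (hτ.trans hτt), one_apply_eq_self, ← hre] at hgronwall

/-! ### The a priori bound -/

theorem re_inner_P_zero_add_jump_le (hM : M.WeakDomainContinuity) (hτ : 0 ≤ τ) (hτt : τ ≤ t)
    (hBL : LeOp B (L τ)) (hY : IsAdmissible τ Y) (hY0 : ∀ s ∈ Icc τ t, 0 ≤ Y s)
    (hYL : ∀ s ∈ Icc τ t, ∀ φ ∈ M.D, (⟪φ, Y s φ⟫_ℂ).re ≤
      Real.exp (∫ r in τ..s, c r) * ‖ev (sqrtOp (L s)) φ‖ ^ 2) (hψ : ψ ∈ M.D) :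
    (⟪ψ, (M.P 0 τ t B + M.jump τ Y t) ψ⟫_ℂ).re ≤
      Real.exp (∫ s in τ..t, c s) * ‖ev (sqrtOp (L t)) ψ‖ ^ 2 := by
  have hjump := hL.norm_sq_add_re_inner_jump_le hM hτ hτt (hL.intervalIntegrable_rate hτ hτt)
    (fun s hs => hL.rate_nonneg s (hτ.trans hs.1)) hY hψ fun s hs => by
      have hs0 := hτ.trans hs.1
      rw [Real.exp_neg]
      exact hL.inv_mul_phi_re_le hs0 (hY0 s hs) (Real.exp_pos _) (hYL s hs)
        (hM.evolution.maps_core s t hs0 hs.2 ψ hψ)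
  have hinit := (hL.leOp_iff hτ).1 hBL _ (hM.evolution.maps_core τ t hτ hτt ψ hψ)
  rw [add_apply, inner_add_right, Complex.add_re, inner_P_zero]
  linarith

theorem re_inner_P_le (hM : M.WeakDomainContinuity) (hτ : 0 ≤ τ) (hτt : τ ≤ t) (hB : 0 ≤ B)
    (hBL : LeOp B (L τ)) (n : ℕ) (hψ : ψ ∈ M.D) :
    (⟪ψ, M.P n τ t B ψ⟫_ℂ).re ≤
      Real.exp (∫ s in τ..t, c s) * ‖ev (sqrtOp (L t)) ψ‖ ^ 2 := by
  induction n generalizing t ψ with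
  | zero =>
    have hzero := (isAdmissible_one (H := H) τ).smul 0
    refine le_trans (re_inner_mono (le_add_of_nonneg_right
      (hM.jump_nonneg hτ hτt hzero fun s _ => by simp)) ψ)
      (hL.re_inner_P_zero_add_jump_le hM hτ hτt hBL hzero (fun s _ => by simp)
        (fun s _ φ _ => ?_) hψ)
    simpa using mul_nonneg (Real.exp_nonneg _) (sq_nonneg _)
  | succ n ih =>
    rw [hM.P_succ hτ hτt]
    exact hL.re_inner_P_zero_add_jump_le hM hτ hτt hBL (hM.isAdmissible_P hτ n B)
      (fun s hs => hM.P_nonneg hτ hs.1 n hB) (fun s hs φ hφ => ih hs.1 hφ) hψ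

theorem PminExt_le (hM : M.WeakDomainContinuity) (hτ : 0 ≤ τ) (hτt : τ ≤ t)
    (hψ : ψ ∈ (sqrtOp (L t)).domain) :
    M.PminExt τ t (L τ) ψ ≤
      ENNReal.ofReal (Real.exp (∫ s in τ..t, c s) * ‖ev (sqrtOp (L t)) ψ‖ ^ 2) := by
  refine iSup_le fun X => iSup_le fun hX => iSup_le fun hXL => ENNReal.ofReal_le_ofReal ?_
  have hlim := (hM.isLUB_Pmin_and_tendsto_P hτ hτt hX).2 ψ
  exact le_of_tendsto ((Complex.continuous_re.tendsto _).comp hlim) (Eventually.of_forall fun n =>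
    re_inner_le_of_hasCore (hL.core t (hτ.trans hτt))
      (fun φ hφ => hL.re_inner_P_le hM hτ hτt hX hXL n hφ) hψ)

end IsWeakReferenceFamily

/-! ### Unitality -/

/-- The expected number of jumps during `[τ, t]`, truncated at `n`: the defect `1 - P⁽ᵏ⁾(1)` is the
probability of more than `k` jumps. -/
def jumpCount (M : MarkovMasterEquation H) (n : ℕ) (τ t : ℝ) : H →L[ℂ] H :=
  ∑ k ∈ Finset.range n, (1 - M.P k τ t 1)

variable [TopologicalSpace.SeparableSpace H]

namespace WeakDomainContinuity

variable (hM : M.WeakDomainContinuity)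
include hM

theorem P_one_le_one (hτ : 0 ≤ τ) (hτt : τ ≤ t) (n : ℕ) : M.P n τ t 1 ≤ 1 := by
  simpa using hM.P_le_smul_one (b := 1) (B := 1) hτ hτt (by simp) (by simp) n

theorem jumpCount_nonneg (hτ : 0 ≤ τ) (hτt : τ ≤ t) (n : ℕ) : 0 ≤ M.jumpCount n τ t :=
  Finset.sum_nonneg fun k _ => sub_nonneg.2 (hM.P_one_le_one hτ hτt k)

theorem isAdmissible_jumpCount (hτ : 0 ≤ τ) (n : ℕ) : IsAdmissible τ (M.jumpCount n τ) := by
  induction n with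
  | zero => exact ((isAdmissible_one τ).smul 0).congr fun t _ => by simp [jumpCount]
  | succ n ih =>
    exact (ih.add ((isAdmissible_one τ).sub (hM.isAdmissible_P hτ n 1))).congr
      fun t _ => (Finset.sum_range_succ (fun k => 1 - M.P k τ t 1) n).symm

theorem one_sub_P_zero (hτ : 0 ≤ τ) (hτt : τ ≤ t) : 1 - M.P 0 τ t 1 = M.jump τ 1 t :=
  sub_eq_of_eq_add' (hM.P_zero_one_add_jump_one hτ hτt).symm

theorem one_sub_P_succ (hτ : 0 ≤ τ) (hτt : τ ≤ t) (n : ℕ) :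
    1 - M.P (n + 1) τ t 1 = M.jump τ (fun s => 1 - M.P n τ s 1) t := by
  rw [hM.P_succ hτ hτt, ← sub_sub, hM.one_sub_P_zero hτ hτt]
  exact (hM.jump_sub hτ hτt (isAdmissible_one τ) (hM.isAdmissible_P hτ n 1)).symm

theorem jumpCount_succ (hτ : 0 ≤ τ) (hτt : τ ≤ t) (n : ℕ) :
    M.jumpCount (n + 1) τ t = M.jump τ (1 + M.jumpCount n τ) t := by
  induction n with
  | zero =>
    rw [jumpCount, Finset.sum_range_one, hM.one_sub_P_zero hτ hτt]
    congr 1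
    funext s
    simp [jumpCount]
  | succ n ih =>
    have hcount := hM.isAdmissible_jumpCount hτ n
    have hdefect := (isAdmissible_one τ).sub (hM.isAdmissible_P hτ n 1)
    have hsplit : 1 + M.jumpCount (n + 1) τ =
        (1 + M.jumpCount n τ) + ((1 : ℝ → H →L[ℂ] H) - fun s => M.P n τ s 1) := by
      funext s
      simp only [jumpCount, Pi.add_apply, Pi.sub_apply, Pi.one_apply, Finset.sum_range_succ,
        add_assoc]
    rw [hsplit, hM.jump_add hτ hτt ((isAdmissible_one τ).add hcount) hdefect, ← ih,
      jumpCount, Finset.sum_range_succ, hM.one_sub_P_succ hτ hτt]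
    rfl

theorem mul_re_inner_one_sub_Pmin_le (hτ : 0 ≤ τ) (hτt : τ ≤ t) (n : ℕ) (ψ : H) :
    n * (⟪ψ, (1 - M.Pmin τ t 1) ψ⟫_ℂ).re ≤ (⟪ψ, M.jumpCount n τ t ψ⟫_ℂ).re := by
  have hlub := (hM.isLUB_Pmin_and_tendsto_P hτ hτt (zero_le_one (α := H →L[ℂ] H))).1
  have hle : ∀ k ∈ Finset.range n, (⟪ψ, (1 - M.Pmin τ t 1) ψ⟫_ℂ).re ≤
      (⟪ψ, (1 - M.P k τ t 1) ψ⟫_ℂ).re := fun k _ =>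
    re_inner_mono (sub_le_sub_left (hlub.1 ⟨k, rfl⟩) 1) ψ
  rw [jumpCount, sum_apply, inner_sum, Complex.re_sum]
  simpa only [Finset.card_range, nsmul_eq_mul] using Finset.card_nsmul_le_sum _ _ _ hle

end WeakDomainContinuity

namespace IsWeakReferenceFamily

variable (hL : M.IsWeakReferenceFamily L c)
include hL

/-- The rate `c + 1` accounts for the additional jump through `Φₛ(I) ≤ L s`. -/
theorem re_inner_jumpCount_le (hM : M.WeakDomainContinuity) (hτ : 0 ≤ τ) (hτt : τ ≤ t) (n : ℕ)
    (hψ : ψ ∈ M.D) : (⟪ψ, M.jumpCount n τ t ψ⟫_ℂ).re ≤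
      Real.exp (∫ s in τ..t, (c s + 1)) * ‖ev (sqrtOp (L t)) ψ‖ ^ 2 := by
  induction n generalizing t ψ with
  | zero => simpa [jumpCount] using mul_nonneg (Real.exp_nonneg _) (sq_nonneg _)
  | succ n ih =>
    have hrate : ∀ s ∈ Icc τ t, 0 ≤ c s + 1 := fun s hs =>
      add_nonneg (hL.rate_nonneg s (hτ.trans hs.1)) zero_le_one
    rw [hM.jumpCount_succ hτ hτt]
    refine (le_add_of_nonneg_left (sq_nonneg _)).trans (hL.norm_sq_add_re_inner_jump_le hM hτ hτt
      ((hL.intervalIntegrable_rate hτ hτt).add intervalIntegrable_const) hrate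
      ((isAdmissible_one τ).add (hM.isAdmissible_jumpCount hτ n)) hψ fun s hs => ?_)
    have hs0 := hτ.trans hs.1
    have hWD := hM.evolution.maps_core s t hs0 hs.2 ψ hψ
    have hexp : Real.exp (-∫ r in τ..s, (c r + 1)) ≤ 1 :=
      Real.exp_le_one_iff.2 (neg_nonpos.2 (intervalIntegral.integral_nonneg hs.1
        fun r hr => hrate r ⟨hr.1, hr.2.trans hs.2⟩))
    have hone := (mul_le_of_le_one_left (phi_one_re_nonneg s (M.W s t ψ)) hexp).trans
      (hL.phi_one_le s hs0 _ hWD)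
    have hcount := hL.inv_mul_phi_re_le hs0 (hM.jumpCount_nonneg hτ hs.1 n) (Real.exp_pos _)
      (fun φ hφ => ih hs.1 hφ) hWD
    rw [← Real.exp_neg] at hcount
    simp only [phiAlong, phi, Pi.add_apply, Pi.one_apply, map_add, add_apply, inner_add_right,
      Complex.add_re, mul_add] at hone hcount ⊢
    linarith

theorem Pmin_one (hM : M.WeakDomainContinuity) (hτ : 0 ≤ τ) (hτt : τ ≤ t) : M.Pmin τ t 1 = 1 := by
  have hlub := (hM.isLUB_Pmin_and_tendsto_P hτ hτt (zero_le_one (α := H →L[ℂ] H))).1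
  have hle : M.Pmin τ t 1 ≤ 1 := hlub.2 (forall_mem_range.2 (hM.P_one_le_one hτ hτt))
  refine hle.antisymm (le_of_sub_nonpos (le_of_forall_inner_le hM.dense_D fun ψ hψ => ?_))
  have hsa : IsSelfAdjoint (1 - M.Pmin τ t 1) := IsSelfAdjoint.of_nonneg (sub_nonneg.2 hle)
  rw [zero_apply, inner_zero_right, ← coe_re_inner_of_isSelfAdjoint hsa ψ]
  norm_cast
  refine not_lt.1 fun hpos => ?_
  obtain ⟨n, hn⟩ := exists_nat_gt (Real.exp (∫ s in τ..t, (c s + 1)) *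
    ‖ev (sqrtOp (L t)) ψ‖ ^ 2 / (⟪ψ, (1 - M.Pmin τ t 1) ψ⟫_ℂ).re)
  rw [div_lt_iff₀ hpos] at hn
  exact hn.not_ge ((hM.mul_re_inner_one_sub_Pmin_le hτ hτt n ψ).trans
    (hL.re_inner_jumpCount_le hM hτ hτt n hψ))

end IsWeakReferenceFamily

end MarkovMasterEquation

end

theorem theorem2p1_general {H : Type*} [NormedAddCommGroup H] [InnerProductSpace ℂ H]
    [CompleteSpace H] [TopologicalSpace.SeparableSpace H] (M : MarkovMasterEquation H)
    (hM : M.WeakDomainContinuity) (L : ℝ → (H →ₗ.[ℂ] H)) (c : ℝ → ℝ)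
    (hL : M.IsWeakReferenceFamily L c) :
    M.IteratesWellDefined ∧
    (∀ τ t : ℝ, 0 ≤ τ → τ ≤ t → ∀ B : H →L[ℂ] H, 0 ≤ B →
      IsLUB (Set.range fun n => M.P n τ t B) (M.Pmin τ t B)) ∧
    (∀ τ t : ℝ, 0 ≤ τ → τ ≤ t → ∀ ψ ∈ (MME.sqrtOp (L t)).domain,
      M.PminExt τ t (L τ) ψ ≤
        ENNReal.ofReal (Real.exp (∫ s in τ..t, c s) * ‖MME.ev (MME.sqrtOp (L t)) ψ‖ ^ 2)) ∧
    (∀ τ t : ℝ, 0 ≤ τ → τ ≤ t → M.Pmin τ t 1 = 1) :=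
  ⟨hM.iteratesWellDefined,
    fun _ _ hτ hτt _ hB => (hM.isLUB_Pmin_and_tendsto_P hτ hτt hB).1,
    fun _ _ hτ hτt _ hψ => hL.PminExt_le hM hτ hτt hψ,
    fun _ _ hτ hτt => hL.Pmin_one hM hτ hτt⟩

theorem theorem2p1 {H : Type*} [NormedAddCommGroup H] [InnerProductSpace ℂ H] [CompleteSpace H]
    [TopologicalSpace.SeparableSpace H] (M : MarkovMasterEquation H) (hM : M.DomainContinuity)
    (L : ℝ → (H →ₗ.[ℂ] H)) (c : ℝ → ℝ) (hL : M.IsReferenceFamily L c) :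
    M.IteratesWellDefined ∧
    (∀ τ t : ℝ, 0 ≤ τ → τ ≤ t → ∀ B : H →L[ℂ] H, 0 ≤ B →
      IsLUB (Set.range fun n => M.P n τ t B) (M.Pmin τ t B)) ∧
    (∀ τ t : ℝ, 0 ≤ τ → τ ≤ t → ∀ ψ ∈ (MME.sqrtOp (L t)).domain,
      M.PminExt τ t (L τ) ψ ≤
        ENNReal.ofReal (Real.exp (∫ s in τ..t, c s) * ‖MME.ev (MME.sqrtOp (L t)) ψ‖ ^ 2)) ∧
    (∀ τ t : ℝ, 0 ≤ τ → τ ≤ t → M.Pmin τ t 1 = 1) :=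
  theorem2p1_general M hM.weaken L c hL.weaken
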